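/- Let $X$ be a smooth connected $2$-dimensional Riemannian manifold without boundary. For a $2$-dimensional $C^0$-submanifold $Y\subset X$ with boundary (every point of $Y$ has an open neighbourhood in $X$ and a homeomorphism from it onto an open subset of $\mathbb R^2$ carrying the points of $Y$ exactly to the points lying in a closed half-plane), with manifold interior $\operatorname{Int}Y$ and manifold boundary $\partial Y$, put, for $x,y\in Y$, $$\rho_Y(x,y)=\liminf_{x'\to x,\;y'\to y;\;x',y'\in\operatorname{Int}Y}\ \inf_{\gamma}\, l(\gamma)\in[0,\infty],$$ where $\gamma$ runs over the smooth paths $\gamma:[0,1]\to\operatorname{Int}Y$ from $x'$ to $y'$ and $l(\gamma)$ is the Riemannian length of $\gamma$ (the infimum is $\infty$ if there is no such path). Condition (i) for $Y$ says that $\rho_Y(x,y)<\infty$ for all $x,y\in Y$. For $\alpha,\beta\in Y$, a shortest path from $\alpha$ to $\beta$ in $\rho_Y$ is a path $\gamma:[0,1]\to Y$ with $\gamma(0)=\alpha$, $\gamma(1)=\beta$ and $\rho_Y(\gamma(s),\gamma(t))=(t-s)\,\rho_Y(\alpha,\beta)$ for $0\le s\le t\le 1$. We say that $Y$ satisfies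 the strict convexity condition if, for all $\alpha\ne\beta$ in $Y$, every shortest path $\gamma$ from $\alpha$ to $\beta$ in $\rho_Y$ satisfies $\gamma(]0,1[)\subset\operatorname{Int}Y$. **Theorem.** Let $Y_1,Y_2\subset X$ be compact connected $2$-dimensional $C^0$-submanifolds with nonempty boundaries, both satisfying (i), and suppose that $Y_1$ satisfies the strict convexity condition. Suppose that $\partial Y_1$ and $\partial Y_2$ are isometric in the metrics $\rho_{Y_j}$, i.e. there is a bijection $f:\partial Y_1\to\partial Y_2$ with $\rho_{Y_2}(f(x),f(y))=\rho_{Y_1}(x,y)$ for all $x,y\in\partial Y_1$. Then $Y_2$ is strictly convex with respect to $\rho_{Y_2}$; that is, $\rho_{Y_2}$ is a metric on $Y_2$ and $Y_2$ satisfies the strict convexity condition. -/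

import Mathlib

open Set Filter Topology Bundle Manifold
open scoped ENNReal ContDiff

namespace BoundaryRigidity

section Topological

variable {X : Type*} [TopologicalSpace X]

/-- A local chart `e` of the topological surface `X` (a homeomorphism from an open subset of `X`
onto an open subset of the plane) is adapted to `Y` if, on its domain, it identifies `Y` with the
closed half-plane `{p | 0 ≤ p 0}`. -/
def IsAdaptedChart (Y : Set X) (e : OpenPartialHomeomorph X (EuclideanSpace ℝ (Fin 2))) : Prop :=
  ∀ x ∈ e.source, x ∈ Y ↔ 0 ≤ e x 0

/-- `Y` is a `2`-dimensional `C^0`-submanifold, possibly with boundary, of the surface `X`: every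
point of `Y` lies in the domain of an adapted chart. (For an interior point of `Y` the image of the
chart may be contained in the open half-plane.) -/
def IsC0Submanifold (Y : Set X) : Prop :=
  ∀ y ∈ Y, ∃ e : OpenPartialHomeomorph X (EuclideanSpace ℝ (Fin 2)),
    y ∈ e.source ∧ IsAdaptedChart Y e

/-- `Int Y`, the manifold interior: the points sent into the open half-plane by an adapted chart. -/
def interiorPts (Y : Set X) : Set X :=
  {y | ∃ e : OpenPartialHomeomorph X (EuclideanSpace ℝ (Fin 2)),
    y ∈ e.source ∧ IsAdaptedChart Y e ∧ 0 < e y 0}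

/-- `∂Y`, the manifold boundary: the points sent onto the boundary line of the half-plane by an adapted chart. -/
def boundaryPts (Y : Set X) : Set X :=
  {y | ∃ e : OpenPartialHomeomorph X (EuclideanSpace ℝ (Fin 2)),
    y ∈ e.source ∧ IsAdaptedChart Y e ∧ e y 0 = 0}

/-- `d` satisfies the axioms of a (finite) metric on the set `Y`. -/
structure IsMetricOn (d : X → X → ℝ≥0∞) (Y : Set X) : Prop where
  lt_top : ∀ x ∈ Y, ∀ y ∈ Y, d x y < ⊤
  eq_zero_iff : ∀ x ∈ Y, ∀ y ∈ Y, (d x y = 0 ↔ x = y)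
  symm : ∀ x ∈ Y, ∀ y ∈ Y, d x y = d y x
  triangle : ∀ x ∈ Y, ∀ y ∈ Y, ∀ z ∈ Y, d x z ≤ d x y + d y z

/-- `γ : [0,1] → Y` is a shortest path from `α` to `β` for the distance function `d`, parametrized
proportionally to arc length: `d (γ s) (γ t) = (t - s) * d α β` for `0 ≤ s ≤ t ≤ 1`. Only the
values of `γ` on `[0,1]` matter. -/
structure IsShortestPath (d : X → X → ℝ≥0∞) (Y : Set X) (α β : X) (γ : ℝ → X) : Prop where
  continuousOn : ContinuousOn γ (Icc 0 1)
  mapsTo : MapsTo γ (Icc 0 1) Y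
  source : γ 0 = α
  target : γ 1 = β
  dist_eq : ∀ s ∈ Icc (0 : ℝ) 1, ∀ t ∈ Icc (0 : ℝ) 1, s ≤ t →
    d (γ s) (γ t) = ENNReal.ofReal (t - s) * d α β

/-- Strict convexity of `Y` for the distance function `d`: the interior points of every shortest
path in `Y` between two distinct points of `Y` lie in `Int Y`. -/
def IsStrictlyConvex (d : X → X → ℝ≥0∞) (Y : Set X) : Prop :=
  ∀ α ∈ Y, ∀ β ∈ Y, α ≠ β → ∀ γ : ℝ → X, IsShortestPath d Y α β γ →
    ∀ t ∈ Ioo (0 : ℝ) 1, γ t ∈ interiorPts Y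

end Topological

noncomputable section Riemannian

variable {X : Type*} [TopologicalSpace X] [ChartedSpace (EuclideanSpace ℝ (Fin 2)) X]
  [RiemannianBundle (fun x : X ↦ TangentSpace (𝓡 2) x)]

/-- The infimum of the Riemannian lengths of the smooth paths `[0,1] → U` joining `x` and `y`
inside `U` (it is `∞` if there is no such path). -/
def innerDist (U : Set X) (x y : X) : ℝ≥0∞ :=
  ⨅ (γ : ℝ → X) (_ : ContMDiffOn 𝓘(ℝ, ℝ) (𝓡 2) ∞ γ (Icc 0 1)) (_ : MapsTo γ (Icc 0 1) U)
    (_ : γ 0 = x) (_ : γ 1 = y), pathELength (𝓡 2) γ 0 1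

/-- `ρ_Y(x,y)`: the lower limit, for `x' → x` and `y' → y` with `x', y' ∈ Int Y`, of the infimum of
the lengths of smooth paths joining `x'` and `y'` in `Int Y`. -/
def rho (Y : Set X) (x y : X) : ℝ≥0∞ :=
  liminf (fun p : X × X ↦ innerDist (interiorPts Y) p.1 p.2)
    (𝓝[interiorPts Y] x ×ˢ 𝓝[interiorPts Y] y)

/-- Condition (i): `ρ_Y` is finite on `Y`. -/
def RhoFinite (Y : Set X) : Prop :=
  ∀ x ∈ Y, ∀ y ∈ Y, rho Y x y < ⊤

end Riemannian

end BoundaryRigidity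

/-!
The key is that strict convexity of `Y` is a condition on the metric space `∂Y` alone: it holds if
and only if `ρ(a, b) < ρ(a, m) + ρ(m, b)` for all boundary points `a ≠ m ≠ b`. A bijection of the
boundaries that preserves `ρ` then carries it from `Y₁` to `Y₂`.

If equality holds for some triple of boundary points, the concatenation of shortest paths from `a`
to `m` and from `m` to `b` is a shortest path that touches the boundary at `m`, so `Y` is not
strictly convex (`rho_ne_add_of_isStrictlyConvex`). Shortest paths exist because `Y` is compact:
almost shortest paths, parametrized proportionally to length, converge pointwise along an
ultrafilter (`exists_isShortestPath`).

Conversely, suppose that the inequality is strict and that a shortest path `γ` passes through a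
boundary point `z` at an interior time (`isStrictlyConvex_of_rho_ne_add`). By strictness `γ` has at
most two boundary points, so it is in `Int Y` just before and just after `z`. There are boundary
points `a` and `b` on the two sides of `z` that are `ρ`-close to `z`
(`IsBoundaryChart.exists_rho_le`). A shortest path `σ` from `a` to `b` stays in a half-disc around
`z`, and by strictness it avoids `z`; hence it separates `z` from the circular side and crosses `γ`
both before and after `z` (`exists_eq_of_crossing`). Exchanging the part of `σ` between the two
crossings for that of `γ` gives a shortest path from `a` to `b` through `z`, contrary to strictness.

Both the triangle inequality of `ρ` at a boundary point and the choice of `a` and `b` rest on one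
fact of plane topology. Although `ρ` need not be continuous on `Y`, two paths in a half-disc that
run from its circular side to points very close to the centre `z` are joined by a short path in
`Int Y` (`IsBoundaryChart.exists_innerDist_lt`): an arc, contained in `Int Y`, of a small circle
around `z` in a *smooth* chart. It is found by interpolating the two paths in polar coordinates of
the topological chart, which gives a square in `Int Y`; in this square the level set of the smooth
distance to `z` has a connected part that joins the two paths
(`exists_isPreconnected_level_set`, `exists_arc_of_paths`). This is a form of the Poincaré–Miranda
theorem, which is proved with continuous logarithms (`poincare_miranda`).
-/

namespace BoundaryRigidity

open scoped NNReal

/-! ### The Poincaré–Miranda theorem and connected level sets in the square -/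

/-- A nowhere vanishing continuous function on the unit square has a continuous logarithm. -/
lemma exists_continuous_log {f : ℝ × ℝ → ℂ} (hf : ContinuousOn f (Icc 0 1 ×ˢ Icc 0 1))
    (h0 : ∀ p ∈ Icc (0 : ℝ) 1 ×ˢ Icc (0 : ℝ) 1, f p ≠ 0) :
    ∃ L : ℝ × ℝ → ℂ, Continuous L ∧
      ∀ p ∈ Icc (0 : ℝ) 1 ×ˢ Icc (0 : ℝ) 1, Complex.exp (L p) = f p := by
  have h01 : (0 : ℝ) ≤ 1 := zero_le_one
  -- the retraction of the plane onto the square makes the domain simply connected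
  let r : ℝ × ℝ → ℝ × ℝ := fun p ↦ (projIcc 0 1 h01 p.1, projIcc 0 1 h01 p.2)
  have hr : ∀ p, r p ∈ Icc (0 : ℝ) 1 ×ˢ Icc (0 : ℝ) 1 := fun p ↦
    ⟨(projIcc 0 1 h01 p.1).2, (projIcc 0 1 h01 p.2).2⟩
  have hrc : Continuous r := by
    refine Continuous.prodMk ?_ ?_
    · exact continuous_subtype_val.comp (continuous_projIcc.comp continuous_fst)
    · exact continuous_subtype_val.comp (continuous_projIcc.comp continuous_snd)
  have hrid : ∀ p ∈ Icc (0 : ℝ) 1 ×ˢ Icc (0 : ℝ) 1, r p = p := fun p hp ↦ by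
    simp [r, projIcc_of_mem h01 hp.1, projIcc_of_mem h01 hp.2]
  let g : C(ℝ × ℝ, ℂ) := ⟨fun p ↦ f (r p), hf.comp_continuous hrc hr⟩
  have hg : ∀ p, g p ≠ 0 := fun p ↦ h0 _ (hr p)
  obtain ⟨L, ⟨-, hL⟩, -⟩ := Complex.isCoveringMapOn_exp.existsUnique_continuousMap_lifts g
    (a₀ := 0) (e₀ := Complex.log (g 0)) (Complex.exp_log (hg 0)) (fun p ↦ by simpa using hg p)
  refine ⟨L, L.continuous, fun p hp ↦ ?_⟩
  have := congrFun hL p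
  simp only [Function.comp_apply] at this
  rw [this]
  simp [g, hrid p hp]

/-- If a path in the closed right half-plane minus the origin is multiplied by a constant, every
continuous logarithm of the result changes its imaginary part by the change of the principal
argument of the original path. -/
lemma im_log_sub_eq_arg_sub {L h : ℝ → ℂ} {c : ℂ} (hL : ContinuousOn L (Icc 0 1))
    (hexp : ∀ t ∈ Icc (0 : ℝ) 1, c * Complex.exp (L t) = h t)
    (hc : c ≠ 0) (hre : ∀ t ∈ Icc (0 : ℝ) 1, 0 ≤ (h t).re) :
    (L 1).im - (L 0).im = (h 1).arg - (h 0).arg := by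
  have hh : ContinuousOn h (Icc 0 1) :=
    ContinuousOn.congr (continuousOn_const.mul (Complex.continuous_exp.comp_continuousOn hL))
      (fun t ht ↦ (hexp t ht).symm)
  have hne : ∀ t ∈ Icc (0 : ℝ) 1, h t ≠ 0 := fun t ht ↦ by
    rw [← hexp t ht]; exact mul_ne_zero hc (Complex.exp_ne_zero _)
  have hslit : ∀ t ∈ Icc (0 : ℝ) 1, h t ∈ Complex.slitPlane := fun t ht ↦ by
    rw [Complex.mem_slitPlane_iff]
    rcases (hre t ht).eq_or_lt with h1 | h1
    · right; intro h2; exact hne t ht (Complex.ext h1.symm h2)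
    · exact Or.inl h1
  have hlog : ContinuousOn (fun t ↦ Complex.log (h t)) (Icc 0 1) := fun t ht ↦
    (hh t ht).clog (hslit t ht)
  have hK : ContinuousOn (fun t ↦ L t + Complex.log c) (Icc 0 1) := hL.add continuousOn_const
  have hD : ContinuousOn (fun t ↦ Complex.log (h t) - (L t + Complex.log c)) (Icc 0 1) :=
    hlog.sub hK
  have key : ∀ t ∈ Icc (0 : ℝ) 1, ∃ n : ℤ,
      Complex.log (h t) - (L t + Complex.log c) = n * (2 * Real.pi * Complex.I) := fun t ht ↦ by
    rw [← Complex.exp_eq_one_iff, Complex.exp_sub, Complex.exp_log (hne t ht), Complex.exp_add,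
      Complex.exp_log hc, ← hexp t ht, mul_comm c, div_self]
    exact mul_ne_zero (Complex.exp_ne_zero _) hc
  have hconst : (Complex.log (h 1) - (L 1 + Complex.log c)).im =
      (Complex.log (h 0) - (L 0 + Complex.log c)).im := by
    refine isPreconnected_Icc.constant_of_mapsTo (S := Icc (0 : ℝ) 1)
      (T := (AddSubgroup.zmultiples (2 * Real.pi) : Set ℝ))
      (f := fun t ↦ (Complex.log (h t) - (L t + Complex.log c)).im)
      (isDiscrete_iff_discreteTopology.2
        (inferInstanceAs (DiscreteTopology (AddSubgroup.zmultiples (2 * Real.pi)))))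
      (Complex.continuous_im.comp_continuousOn hD) (fun t ht ↦ ?_) (by simp) (by simp)
    obtain ⟨n, hn⟩ := key t ht
    refine AddSubgroup.mem_zmultiples_iff.2 ⟨n, ?_⟩
    simp only
    rw [hn]
    simp
  simp only [Complex.sub_im, Complex.add_im, Complex.log_im] at hconst
  linarith

lemma arg_eq_arg_neg_I_mul_add {w : ℂ} (hw : w ≠ 0) (hre : 0 ≤ w.re) (him : 0 ≤ w.im) :
    w.arg = (-Complex.I * w).arg + Real.pi / 2 := by
  have h1 : 0 ≤ w.arg := Complex.arg_nonneg_iff.2 him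
  have h2 : w.arg ≤ Real.pi / 2 := (abs_le.1 (Complex.abs_arg_le_pi_div_two_iff.2 hre)).2
  have := Real.pi_pos
  have h3 : -Complex.I * w = (‖w‖ : ℂ) * Complex.exp ((w.arg - Real.pi / 2 : ℝ) * Complex.I) := by
    conv_lhs => rw [← Complex.norm_mul_exp_arg_mul_I w]
    push_cast
    rw [sub_mul, sub_eq_add_neg, Complex.exp_add, ← neg_mul, ← neg_div,
      Complex.exp_neg_pi_div_two_mul_I]
    ring
  rw [h3, Complex.arg_real_mul _ (norm_pos_iff.2 hw), Complex.arg_exp_mul_I,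
    (toIocMod_eq_self _).2 ⟨by linarith, by linarith⟩]
  ring

/-- The **Poincaré–Miranda theorem** on the unit square. -/
theorem poincare_miranda {f g : ℝ × ℝ → ℝ} (hf : ContinuousOn f (Icc 0 1 ×ˢ Icc 0 1))
    (hg : ContinuousOn g (Icc 0 1 ×ˢ Icc 0 1))
    (hf0 : ∀ v ∈ Icc (0 : ℝ) 1, f (0, v) ≤ 0) (hf1 : ∀ v ∈ Icc (0 : ℝ) 1, 0 ≤ f (1, v))
    (hg0 : ∀ u ∈ Icc (0 : ℝ) 1, g (u, 0) ≤ 0) (hg1 : ∀ u ∈ Icc (0 : ℝ) 1, 0 ≤ g (u, 1)) :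
    ∃ p ∈ Icc (0 : ℝ) 1 ×ˢ Icc (0 : ℝ) 1, f p = 0 ∧ g p = 0 := by
  by_contra! hcon
  let h : ℝ × ℝ → ℂ := fun p ↦ f p + g p * Complex.I
  have hre : ∀ p, (h p).re = f p := fun p ↦ by simp [h]
  have him : ∀ p, (h p).im = g p := fun p ↦ by simp [h]
  have hh : ContinuousOn h (Icc 0 1 ×ˢ Icc 0 1) :=
    (Complex.continuous_ofReal.comp_continuousOn hf).add
      ((Complex.continuous_ofReal.comp_continuousOn hg).mul continuousOn_const)
  have hne : ∀ p ∈ Icc (0 : ℝ) 1 ×ˢ Icc (0 : ℝ) 1, h p ≠ 0 := fun p hp h0 ↦ by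
    refine hcon p hp ?_ ?_
    · rw [← hre, h0]; rfl
    · rw [← him, h0]; rfl
  obtain ⟨L, hL, hexp⟩ := exists_continuous_log hh hne
  have m0 : (0 : ℝ) ∈ Icc (0 : ℝ) 1 := by simp
  have m1 : (1 : ℝ) ∈ Icc (0 : ℝ) 1 := by simp
  -- the change of the argument along each of the four sides
  have right := im_log_sub_eq_arg_sub (L := fun v ↦ L (1, v)) (h := fun v ↦ h (1, v)) (c := 1)
    (by fun_prop) (fun t ht ↦ by rw [one_mul]; exact hexp _ ⟨m1, ht⟩) one_ne_zero
    (fun t ht ↦ by rw [hre]; exact hf1 t ht)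
  have left := im_log_sub_eq_arg_sub (L := fun v ↦ L (0, v)) (h := fun v ↦ -1 * h (0, v)) (c := -1)
    (by fun_prop) (fun t ht ↦ by rw [hexp _ ⟨m0, ht⟩]) (by simp)
    (fun t ht ↦ by simp only [neg_mul, one_mul, Complex.neg_re, hre]; linarith [hf0 t ht])
  have top := im_log_sub_eq_arg_sub (L := fun u ↦ L (u, 1))
    (h := fun u ↦ -Complex.I * h (u, 1)) (c := -Complex.I)
    (by fun_prop) (fun t ht ↦ by rw [hexp _ ⟨ht, m1⟩]) (by simp)
    (fun t ht ↦ by simpa [him] using hg1 t ht)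
  have bottom := im_log_sub_eq_arg_sub (L := fun u ↦ L (u, 0))
    (h := fun u ↦ Complex.I * h (u, 0)) (c := Complex.I)
    (by fun_prop) (fun t ht ↦ by rw [hexp _ ⟨ht, m0⟩]) (by simp)
    (fun t ht ↦ by simpa [him] using hg0 t ht)
  -- the comparison of the two principal arguments at each of the four corners
  have c11 := arg_eq_arg_neg_I_mul_add (w := h (1, 1)) (hne _ ⟨m1, m1⟩)
    (by rw [hre]; exact hf1 1 m1) (by rw [him]; exact hg1 1 m1)
  have c01 := arg_eq_arg_neg_I_mul_add (w := -Complex.I * h (0, 1))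
    (mul_ne_zero (by simp) (hne _ ⟨m0, m1⟩))
    (by simpa [him] using hg1 0 m0) (by simpa [hre] using hf0 1 m1)
  have c00 := arg_eq_arg_neg_I_mul_add (w := -1 * h (0, 0))
    (mul_ne_zero (by simp) (hne _ ⟨m0, m0⟩))
    (by simpa [hre] using hf0 0 m0) (by simpa [him] using hg0 0 m0)
  have c10 := arg_eq_arg_neg_I_mul_add (w := Complex.I * h (1, 0))
    (mul_ne_zero (by simp) (hne _ ⟨m1, m0⟩))
    (by simpa [him] using hg0 1 m1) (by simpa [hre] using hf1 0 m0)
  have e1 : -Complex.I * (-Complex.I * h (0, 1)) = -1 * h (0, 1) := by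
    linear_combination h (0, 1) * Complex.I_mul_I
  have e2 : -Complex.I * (-1 * h (0, 0)) = Complex.I * h (0, 0) := by ring
  have e3 : -Complex.I * (Complex.I * h (1, 0)) = h (1, 0) := by
    linear_combination -h (1, 0) * Complex.I_mul_I
  rw [e1] at c01
  rw [e2] at c00
  rw [e3] at c10
  have := Real.pi_pos
  linarith

/-- If a continuous function on the square is larger than `c` on the bottom side and smaller than
`c` on the top side, then a connected part of its level set `c` joins the left and right sides. -/
theorem exists_isPreconnected_level_set {a : ℝ × ℝ → ℝ} {c : ℝ}
    (ha : ContinuousOn a (Icc 0 1 ×ˢ Icc 0 1))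
    (h0 : ∀ u ∈ Icc (0 : ℝ) 1, c < a (u, 0)) (h1 : ∀ u ∈ Icc (0 : ℝ) 1, a (u, 1) < c) :
    ∃ M ⊆ Icc (0 : ℝ) 1 ×ˢ Icc (0 : ℝ) 1, IsPreconnected M ∧ (∀ p ∈ M, a p = c) ∧
      ∃ v w, (0, v) ∈ M ∧ (1, w) ∈ M := by
  set Q : Set (ℝ × ℝ) := Icc (0 : ℝ) 1 ×ˢ Icc (0 : ℝ) 1 with hQ
  have hQc : IsCompact Q := isCompact_Icc.prod isCompact_Icc
  let K : Set (ℝ × ℝ) := Q ∩ a ⁻¹' {c}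
  have hKcl : IsClosed K := ha.preimage_isClosed_of_isClosed hQc.isClosed isClosed_singleton
  have hK : IsCompact K := hQc.of_isClosed_subset hKcl inter_subset_left
  have : CompactSpace K := isCompact_iff_compactSpace.1 hK
  by_contra! hcon
  -- otherwise a clopen subset of the level set separates its left part from its right part
  let A : Set K := {p | p.1.1 = 0}
  let B : Set K := {p | p.1.1 = 1}
  have hA : IsCompact A := (isClosed_eq (by fun_prop) continuous_const).isCompact
  have hB : IsCompact B := (isClosed_eq (by fun_prop) continuous_const).isCompact
  have hdisj : (ConnectedComponents.mk '' A : Set (ConnectedComponents K)) ⊆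
      (ConnectedComponents.mk '' B)ᶜ := by
    rintro _ ⟨p, hp, rfl⟩ ⟨q, hq, hpq⟩
    rw [ConnectedComponents.coe_eq_coe] at hpq
    refine hcon (Subtype.val '' connectedComponent p) ?_
      (isPreconnected_connectedComponent.image _ continuous_subtype_val.continuousOn) ?_
      p.1.2 q.1.2 ?_ ?_
    · rintro _ ⟨x, -, rfl⟩; exact x.2.1
    · rintro _ ⟨x, -, rfl⟩; exact x.2.2
    · exact ⟨p, mem_connectedComponent, Prod.ext hp rfl⟩
    · exact ⟨q, hpq ▸ mem_connectedComponent, Prod.ext hq rfl⟩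
  obtain ⟨C, hC, hAC, hCB⟩ := exists_clopen_of_closed_subset_open
    (hA.image ConnectedComponents.continuous_coe).isClosed
    (hB.image ConnectedComponents.continuous_coe).isClosed.isOpen_compl hdisj
  let V : Set K := ConnectedComponents.mk ⁻¹' C
  have hV : IsClopen V := hC.preimage ConnectedComponents.continuous_coe
  have hAV : A ⊆ V := fun p hp ↦ hAC ⟨p, hp, rfl⟩
  have hBV : ∀ p ∈ B, p ∉ V := fun p hp hpV ↦ hCB hpV ⟨p, hp, rfl⟩
  have hcV : IsClosed (Subtype.val '' V) := (hV.1.isCompact.image continuous_subtype_val).isClosed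
  have hcV' : IsClosed (Subtype.val '' Vᶜ) :=
    (hV.compl.1.isCompact.image continuous_subtype_val).isClosed
  let S : Set (ℝ × ℝ) := Subtype.val '' V ∪ {0} ×ˢ Icc 0 1
  let T : Set (ℝ × ℝ) := Subtype.val '' Vᶜ ∪ {1} ×ˢ Icc 0 1
  have hS : IsClosed S := hcV.union (isClosed_singleton.prod isClosed_Icc)
  have hT : IsClosed T := hcV'.union (isClosed_singleton.prod isClosed_Icc)
  have hST : Disjoint S T := by
    rw [Set.disjoint_left]
    rintro p (⟨x, hx, rfl⟩ | hp) (⟨y, hy, hxy⟩ | hp')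
    · rw [Subtype.val_injective hxy] at hy; exact hy hx
    · exact hBV x hp'.1 hx
    · subst hxy; exact hy (hAV hp.1)
    · have e0 : p.1 = 0 := hp.1
      have e1 : p.1 = 1 := hp'.1
      rw [e0] at e1; exact zero_ne_one e1
  obtain ⟨φ, hφS, hφT, -⟩ := exists_continuous_zero_one_of_isClosed hS hT hST
  obtain ⟨p, hp, hp1, hp2⟩ := poincare_miranda (f := fun p ↦ φ p - 1 / 2) (g := fun p ↦ c - a p)
    (φ.continuous.sub continuous_const).continuousOn (continuousOn_const.sub ha)
    (fun v hv ↦ by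
      have : φ (0, v) = 0 := hφS (Or.inr ⟨rfl, hv⟩)
      simp [this])
    (fun v hv ↦ by
      have : φ (1, v) = 1 := hφT (Or.inr ⟨rfl, hv⟩)
      norm_num [this])
    (fun u hu ↦ by linarith [h0 u hu]) (fun u hu ↦ by linarith [h1 u hu])
  have hpK : p ∈ K := ⟨hp, by simp only [mem_preimage, mem_singleton_iff]; linarith⟩
  by_cases hpV : (⟨p, hpK⟩ : K) ∈ V
  · have : φ p = 0 := hφS (Or.inl ⟨_, hpV, rfl⟩)
    norm_num [this] at hp1
  · have : φ p = 1 := hφT (Or.inl ⟨⟨p, hpK⟩, hpV, rfl⟩)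
    norm_num [this] at hp1

/-! ### Paths in a half-disc, in polar coordinates -/

lemma continuousOn_arg_comp {h : ℝ → ℂ} {S : Set ℝ} (hh : ContinuousOn h S)
    (hne : ∀ t ∈ S, h t ≠ 0) (hre : ∀ t ∈ S, 0 ≤ (h t).re) :
    ContinuousOn (fun t ↦ (h t).arg) S := fun t ht ↦ by
  have hs : h t ∈ Complex.slitPlane := by
    rw [Complex.mem_slitPlane_iff]
    rcases (hre t ht).eq_or_lt with h1 | h1
    · right; intro h2; exact hne t ht (Complex.ext h1.symm h2)
    · exact Or.inl h1
  exact (Complex.continuousAt_arg hs).comp_continuousWithinAt (hh t ht)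

/-- In the closed half-plane `0 ≤ re`, a path `σ` from the upper to the lower boundary ray meets
every path `g` that starts farther from the origin than all of `σ` and ends closer to it: this is
the Poincaré–Miranda theorem in polar coordinates. -/
theorem exists_eq_of_crossing {σ g : ℝ → ℂ} (hσ : ContinuousOn σ (Icc 0 1))
    (hg : ContinuousOn g (Icc 0 1)) (hσre : ∀ t ∈ Icc (0 : ℝ) 1, 0 ≤ (σ t).re)
    (hgre : ∀ t ∈ Icc (0 : ℝ) 1, 0 ≤ (g t).re) (hσ0 : ∀ t ∈ Icc (0 : ℝ) 1, σ t ≠ 0)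
    (hg0 : ∀ t ∈ Icc (0 : ℝ) 1, g t ≠ 0) (hfar : ∀ t ∈ Icc (0 : ℝ) 1, ‖σ t‖ ≤ ‖g 0‖)
    (hnear : ∀ t ∈ Icc (0 : ℝ) 1, ‖g 1‖ ≤ ‖σ t‖)
    (hleft : (σ 0).arg = Real.pi / 2) (hright : (σ 1).arg = -(Real.pi / 2)) :
    ∃ u ∈ Icc (0 : ℝ) 1, ∃ v ∈ Icc (0 : ℝ) 1, σ u = g v := by
  have harg : ∀ t ∈ Icc (0 : ℝ) 1, |(g t).arg| ≤ Real.pi / 2 := fun t ht ↦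
    Complex.abs_arg_le_pi_div_two_iff.2 (hgre t ht)
  have m1 : MapsTo (Prod.fst : ℝ × ℝ → ℝ) (Icc 0 1 ×ˢ Icc 0 1) (Icc 0 1) := fun p hp ↦ hp.1
  have m2 : MapsTo (Prod.snd : ℝ × ℝ → ℝ) (Icc 0 1 ×ˢ Icc 0 1) (Icc 0 1) := fun p hp ↦ hp.2
  obtain ⟨⟨u, v⟩, ⟨hu, hv⟩, h1, h2⟩ := poincare_miranda
    (f := fun p ↦ (g p.2).arg - (σ p.1).arg) (g := fun p ↦ ‖σ p.1‖ - ‖g p.2‖)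
    (((continuousOn_arg_comp hg hg0 hgre).comp continuousOn_snd m2).sub
      ((continuousOn_arg_comp hσ hσ0 hσre).comp continuousOn_fst m1))
    ((hσ.norm.comp continuousOn_fst m1).sub (hg.norm.comp continuousOn_snd m2))
    (fun v hv ↦ by
      have := abs_le.1 (harg v hv)
      simp only [hleft]; linarith)
    (fun v hv ↦ by
      have := abs_le.1 (harg v hv)
      simp only [hright]; linarith)
    (fun u hu ↦ by linarith [hfar u hu]) (fun u hu ↦ by linarith [hnear u hu])
  exact ⟨u, hu, v, hv, Complex.ext_norm_arg (by simpa [sub_eq_zero] using h2)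
    (by simpa [sub_eq_zero, eq_comm] using h1)⟩

lemma exists_angle_mem_uIcc (a b : ℝ) :
    ∃ θ ∈ uIcc a b, |θ - a| ≤ 2 * Real.pi ∧ ∃ n : ℤ, θ = b + n * (2 * Real.pi) := by
  have hp := Real.two_pi_pos
  wlog hab : a ≤ b generalizing a b
  · obtain ⟨θ, h1, h2, n, h3⟩ := this (-a) (-b) (by linarith)
    refine ⟨-θ, ?_, ?_, -n, ?_⟩
    · rw [uIcc_of_le (by linarith)] at h1
      rw [uIcc_of_ge (by linarith)]
      exact ⟨by linarith [h1.2], by linarith [h1.1]⟩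
    · rw [← abs_neg]; convert h2 using 2; ring
    · push_cast; linarith
  have h1 := Int.floor_le ((b - a) / (2 * Real.pi))
  have h2 := Int.lt_floor_add_one ((b - a) / (2 * Real.pi))
  have h0 : (0 : ℝ) ≤ ⌊(b - a) / (2 * Real.pi)⌋ := by
    exact_mod_cast Int.floor_nonneg.2 (div_nonneg (by linarith) hp.le)
  set n := ⌊(b - a) / (2 * Real.pi)⌋
  rw [le_div_iff₀ hp] at h1
  rw [div_lt_iff₀ hp] at h2
  have h3 : 0 ≤ (n : ℝ) * (2 * Real.pi) := mul_nonneg h0 hp.le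
  refine ⟨b + (-n : ℤ) * (2 * Real.pi), ?_, ?_, -n, rfl⟩
  · rw [uIcc_of_le hab]; push_cast
    exact ⟨by linarith, by linarith⟩
  · push_cast
    rw [abs_le]; constructor <;> linarith

/-- Two paths `A` and `B` in a half-disc, both running from its circular side to points near the
centre, are joined by the `φ`-image of the half-disc along an arc of the circle of radius `s`.
Here `φ` is a nonvanishing function on the half-disc that is larger than `s` on the circular side
and smaller than `s` near the centre. The square obtained by interpolating between `A` and `B` in
polar coordinates is mapped by `φ` into the punctured plane; in logarithmic coordinates the level
set of the modulus contains a connected set joining the sides `A` and `B`. -/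
theorem exists_arc_of_paths {A B : ℝ → ℂ} {φ : ℂ → ℂ} {r δ s : ℝ}
    (hA : ContinuousOn A (Icc 0 1)) (hB : ContinuousOn B (Icc 0 1))
    (hAre : ∀ t ∈ Icc (0 : ℝ) 1, 0 < (A t).re) (hBre : ∀ t ∈ Icc (0 : ℝ) 1, 0 < (B t).re)
    (hAr : ∀ t ∈ Icc (0 : ℝ) 1, ‖A t‖ ≤ r) (hBr : ∀ t ∈ Icc (0 : ℝ) 1, ‖B t‖ ≤ r)
    (hA0 : ‖A 0‖ = r) (hB0 : ‖B 0‖ = r) (hA1 : ‖A 1‖ < δ) (hB1 : ‖B 1‖ < δ)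
    (hφ : ContinuousOn φ {p | 0 < p.re ∧ ‖p‖ ≤ r}) (hφ0 : ∀ p, 0 < p.re → ‖p‖ ≤ r → φ p ≠ 0)
    (hs : 0 < s) (hfar : ∀ p, 0 < p.re → ‖p‖ = r → s < ‖φ p‖)
    (hnear : ∀ p, 0 < p.re → ‖p‖ ≤ r → ‖p‖ < δ → ‖φ p‖ < s) :
    ∃ v ∈ Icc (0 : ℝ) 1, ∃ w ∈ Icc (0 : ℝ) 1, ∃ θ₀ θ₁ : ℝ, |θ₁ - θ₀| ≤ 2 * Real.pi ∧
      φ (A v) = s * Complex.exp (θ₀ * Complex.I) ∧ φ (B w) = s * Complex.exp (θ₁ * Complex.I) ∧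
      ∀ θ ∈ uIcc θ₀ θ₁, ∃ p : ℂ, 0 < p.re ∧ ‖p‖ ≤ r ∧ φ p = s * Complex.exp (θ * Complex.I) := by
  have m1 : MapsTo (Prod.fst : ℝ × ℝ → ℝ) (Icc 0 1 ×ˢ Icc 0 1) (Icc 0 1) := fun p hp ↦ hp.1
  have m2 : MapsTo (Prod.snd : ℝ × ℝ → ℝ) (Icc 0 1 ×ˢ Icc 0 1) (Icc 0 1) := fun p hp ↦ hp.2
  have ne_of_re : ∀ z : ℂ, 0 < z.re → z ≠ 0 := fun z hz h ↦ by simp [h] at hz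
  let N : ℝ × ℝ → ℝ := fun p ↦ (1 - p.1) * ‖A p.2‖ + p.1 * ‖B p.2‖
  let Θ : ℝ × ℝ → ℝ := fun p ↦ (1 - p.1) * (A p.2).arg + p.1 * (B p.2).arg
  let F : ℝ × ℝ → ℂ := fun p ↦ N p * Complex.exp (Θ p * Complex.I)
  have hNc : ContinuousOn N (Icc 0 1 ×ˢ Icc 0 1) :=
    ((continuousOn_const.sub continuousOn_fst).mul (hA.norm.comp continuousOn_snd m2)).add
      (continuousOn_fst.mul (hB.norm.comp continuousOn_snd m2))
  have hΘc : ContinuousOn Θ (Icc 0 1 ×ˢ Icc 0 1) :=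
    ((continuousOn_const.sub continuousOn_fst).mul
      ((continuousOn_arg_comp hA (fun t ht ↦ ne_of_re _ (hAre t ht))
        (fun t ht ↦ (hAre t ht).le)).comp continuousOn_snd m2)).add
      (continuousOn_fst.mul
      ((continuousOn_arg_comp hB (fun t ht ↦ ne_of_re _ (hBre t ht))
        (fun t ht ↦ (hBre t ht).le)).comp continuousOn_snd m2))
  have hFc : ContinuousOn F (Icc 0 1 ×ˢ Icc 0 1) :=
    (Complex.continuous_ofReal.comp_continuousOn hNc).mul
      (Complex.continuous_exp.comp_continuousOn
        ((Complex.continuous_ofReal.comp_continuousOn hΘc).mul continuousOn_const))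
  have hNpos : ∀ p ∈ Icc (0 : ℝ) 1 ×ˢ Icc (0 : ℝ) 1, 0 < N p := by
    rintro ⟨u, v⟩ ⟨⟨hu0, hu1⟩, hv⟩
    simp only at hu0 hu1 hv
    have a1 := norm_pos_iff.2 (ne_of_re _ (hAre v hv))
    have a2 := norm_pos_iff.2 (ne_of_re _ (hBre v hv))
    simp only [N]
    rcases hu0.eq_or_lt with h | h
    · subst h; simpa using ne_of_re _ (hAre v hv)
    · have : 0 ≤ (1 - u) * ‖A v‖ := mul_nonneg (by linarith) a1.le
      have : 0 < u * ‖B v‖ := mul_pos h a2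
      linarith
  have hFnorm : ∀ p ∈ Icc (0 : ℝ) 1 ×ˢ Icc (0 : ℝ) 1, ‖F p‖ = N p := fun p hp ↦ by
    simp only [F, norm_mul, Complex.norm_exp_ofReal_mul_I, mul_one, Complex.norm_real,
      Real.norm_of_nonneg (hNpos p hp).le]
  have hFre : ∀ p ∈ Icc (0 : ℝ) 1 ×ˢ Icc (0 : ℝ) 1, 0 < (F p).re := by
    rintro ⟨u, v⟩ hp
    have hN := hNpos _ hp
    obtain ⟨⟨hu0, hu1⟩, hv⟩ := hp
    simp only at hu0 hu1 hv
    have a1 := abs_lt.1 (Complex.abs_arg_lt_pi_div_two_iff.2 (Or.inl (hAre v hv)))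
    have a2 := abs_lt.1 (Complex.abs_arg_lt_pi_div_two_iff.2 (Or.inl (hBre v hv)))
    have hcos : 0 < Real.cos (Θ (u, v)) := by
      have hmem := (convex_Ioo (-(Real.pi / 2)) (Real.pi / 2)) (x := (A v).arg) a1
        (y := (B v).arg) a2 (a := 1 - u) (b := u) (by linarith) hu0 (by ring)
      exact Real.cos_pos_of_mem_Ioo (by simpa [Θ] using hmem)
    simp only [F, Complex.re_ofReal_mul, Complex.exp_ofReal_mul_I_re]
    exact mul_pos hN hcos
  have hFr : ∀ p ∈ Icc (0 : ℝ) 1 ×ˢ Icc (0 : ℝ) 1, ‖F p‖ ≤ r := fun p hp ↦ by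
    rw [hFnorm p hp]
    have a1 := hAr _ hp.2
    have a2 := hBr _ hp.2
    have := convex_Iic r (x := ‖A p.2‖) a1 (y := ‖B p.2‖) a2 (a := 1 - p.1) (b := p.1)
      (by linarith [hp.1.2]) hp.1.1 (by ring)
    simpa [N] using this
  have hF0 : ∀ v, F (0, v) = A v := fun v ↦ by
    simp [F, N, Θ, Complex.norm_mul_exp_arg_mul_I]
  have hF1 : ∀ v, F (1, v) = B v := fun v ↦ by
    simp [F, N, Θ, Complex.norm_mul_exp_arg_mul_I]
  obtain ⟨L, hL, hexp⟩ := exists_continuous_log (f := φ ∘ F)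
    (hφ.comp hFc (fun p hp ↦ ⟨hFre p hp, hFr p hp⟩))
    (fun p hp ↦ hφ0 _ (hFre p hp) (hFr p hp))
  have hre : ∀ p ∈ Icc (0 : ℝ) 1 ×ˢ Icc (0 : ℝ) 1, Real.exp (L p).re = ‖φ (F p)‖ := fun p hp ↦ by
    rw [← Complex.norm_exp, hexp p hp]; rfl
  have z0 : (0 : ℝ) ∈ Icc (0 : ℝ) 1 := by simp
  have z1 : (1 : ℝ) ∈ Icc (0 : ℝ) 1 := by simp
  obtain ⟨M, hMQ, hMc, hM, v, w, hv, hw⟩ := exists_isPreconnected_level_set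
    (a := fun p ↦ (L p).re) (c := Real.log s) (by fun_prop)
    (fun u hu ↦ by
      have hp : (u, (0 : ℝ)) ∈ Icc (0 : ℝ) 1 ×ˢ Icc (0 : ℝ) 1 := ⟨hu, z0⟩
      rw [Real.log_lt_iff_lt_exp hs, hre _ hp]
      refine hfar _ (hFre _ hp) ?_
      rw [hFnorm _ hp]; simp only [N, hA0, hB0]; ring)
    (fun u hu ↦ by
      have hp : (u, (1 : ℝ)) ∈ Icc (0 : ℝ) 1 ×ˢ Icc (0 : ℝ) 1 := ⟨hu, z1⟩
      rw [Real.lt_log_iff_exp_lt hs, hre _ hp]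
      refine hnear _ (hFre _ hp) (hFr _ hp) ?_
      rw [hFnorm _ hp]
      have := convex_Iio δ (x := ‖A 1‖) hA1 (y := ‖B 1‖) hB1 (a := 1 - u) (b := u)
        (by linarith [hu.2]) hu.1 (by ring)
      simpa [N] using this)
  have hval : ∀ p ∈ M, φ (F p) = s * Complex.exp ((L p).im * Complex.I) := fun p hp ↦ by
    have h1 := hexp p (hMQ hp)
    simp only [Function.comp_apply] at h1
    rw [← h1]
    conv_lhs => rw [← Complex.re_add_im (L p), Complex.exp_add]
    rw [hM p hp, ← Complex.ofReal_exp, Real.exp_log hs]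
  obtain ⟨θ, hθ, hθ2, n, hn⟩ := exists_angle_mem_uIcc (L (0, v)).im (L (1, w)).im
  refine ⟨v, (hMQ hv).2, w, (hMQ hw).2, (L (0, v)).im, θ, hθ2, ?_, ?_, ?_⟩
  · rw [← hF0, hval _ hv]
  · rw [← hF1, hval _ hw, hn]
    congr 1
    rw [Complex.exp_eq_exp_iff_exists_int]
    exact ⟨-n, by push_cast; ring⟩
  · intro η hη
    have hpre := hMc.image (fun p ↦ (L p).im) (by fun_prop)
    have hη' : η ∈ uIcc (L (0, v)).im (L (1, w)).im := uIcc_subset_uIcc_left hθ hη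
    obtain ⟨p, hp, hpη⟩ := hpre.ordConnected.uIcc_subset ⟨_, hv, rfl⟩ ⟨_, hw, rfl⟩ hη'
    simp only at hpη
    exact ⟨F p, hFre p (hMQ hp), hFr p (hMQ hp), by rw [hval p hp, hpη]⟩

/-! ### Lengths of smooth paths -/

section InnerDist

variable {X : Type*} [TopologicalSpace X] [ChartedSpace (EuclideanSpace ℝ (Fin 2)) X]
  [RiemannianBundle (fun x : X ↦ TangentSpace (𝓡 2) x)] {U : Set X} {x y z : X}

lemma innerDist_le_pathELength {γ : ℝ → X} {a b : ℝ} (hab : a ≤ b)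
    (hγ : ContMDiffOn 𝓘(ℝ, ℝ) (𝓡 2) ∞ γ (Icc a b)) (hU : MapsTo γ (Icc a b) U) :
    innerDist U (γ a) (γ b) ≤ pathELength (𝓡 2) γ a b := by
  let η : ℝ → ℝ := fun t ↦ a + t * (b - a)
  have hη : ContDiff ℝ ∞ η := by fun_prop
  have hmaps : MapsTo η (Icc 0 1) (Icc a b) := fun t ht ↦ by
    have h1 : 0 ≤ t * (b - a) := mul_nonneg ht.1 (by linarith)
    have h2 : t * (b - a) ≤ 1 * (b - a) := mul_le_mul_of_nonneg_right ht.2 (by linarith)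
    exact ⟨by simp only [η]; linarith, by simp only [η]; linarith⟩
  have h0 : η 0 = a := by simp [η]
  have h1 : η 1 = b := by simp [η]
  have hlen : pathELength (𝓡 2) (γ ∘ η) 0 1 = pathELength (𝓡 2) γ a b := by
    have := pathELength_comp_of_monotoneOn (I := 𝓡 2) (γ := γ) (f := η) zero_le_one
      (fun s _ t _ hst ↦ by
        have : s * (b - a) ≤ t * (b - a) := mul_le_mul_of_nonneg_right hst (by linarith)
        simp only [η]; linarith)
      (hη.differentiable (by simp)).differentiableOn
      (by rw [h0, h1]; exact hγ.mdifferentiableOn (by simp))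
    rwa [h0, h1] at this
  rw [← hlen]
  exact iInf_le_of_le (γ ∘ η) <| iInf_le_of_le (hγ.comp hη.contMDiff.contMDiffOn hmaps) <|
    iInf_le_of_le (hU.comp hmaps) <| iInf_le_of_le (by simp [h0]) <|
    iInf_le_of_le (by simp [h1]) le_rfl

lemma exists_path_of_innerDist_lt {c : ℝ≥0∞} (h : innerDist U x y < c) :
    ∃ γ : ℝ → X, ContMDiffOn 𝓘(ℝ, ℝ) (𝓡 2) ∞ γ (Icc 0 1) ∧ MapsTo γ (Icc 0 1) U ∧
      γ 0 = x ∧ γ 1 = y ∧ pathELength (𝓡 2) γ 0 1 < c := by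
  simpa only [innerDist, iInf_lt_iff, exists_prop] using h

/-- A path almost realizing `innerDist U x y` can be reparametrized so as to be smooth on the whole
line and locally constant near its endpoints; such paths can be concatenated smoothly. -/
lemma exists_locally_constant_path_of_innerDist_lt {c : ℝ≥0∞} (h : innerDist U x y < c) {a b : ℝ}
    (hab : a < b) :
    ∃ γ : ℝ → X, γ a = x ∧ γ b = y ∧ ContMDiff 𝓘(ℝ, ℝ) (𝓡 2) ∞ γ ∧ (∀ t, γ t ∈ U) ∧
      pathELength (𝓡 2) γ a b < c ∧ γ =ᶠ[𝓝 a] (fun _ ↦ x) ∧ γ =ᶠ[𝓝 b] (fun _ ↦ y) := by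
  rcases exists_path_of_innerDist_lt h with ⟨γ, γ_smooth, hγU, hγx, hγy, hγ⟩
  rcases exists_between hab with ⟨a', haa', ha'b⟩
  rcases exists_between ha'b with ⟨b', ha'b', hb'b⟩
  let η (t : ℝ) : ℝ := Real.smoothTransition ((b' - a')⁻¹ * (t - a'))
  have A (t) (ht : t < a') : η t = 0 := by
    simp only [η, Real.smoothTransition.zero_iff_nonpos]
    apply mul_nonpos_of_nonneg_of_nonpos
    · simpa using ha'b'.le
    · linarith
  have A' (t) (ht : t < a') : (γ ∘ η) t = x := by simp [A t ht, hγx]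
  have B (t) (ht : b' < t) : η t = 1 := by
    simp only [η, Real.smoothTransition.eq_one_iff_one_le, inv_mul_eq_div]
    rw [one_le_div₀] <;> linarith
  have B' (t) (ht : b' < t) : (γ ∘ η) t = y := by simp [B t ht, hγy]
  have hη01 (t) : η t ∈ Icc (0 : ℝ) 1 :=
    ⟨Real.smoothTransition.nonneg _, Real.smoothTransition.le_one _⟩
  refine ⟨γ ∘ η, A' _ haa', B' _ hb'b, ?_, fun t ↦ hγU (hη01 t), ?_, ?_, ?_⟩
  · rw [← contMDiffOn_univ]
    apply γ_smooth.comp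
    · rw [contMDiffOn_univ, contMDiff_iff_contDiff]
      fun_prop
    · exact fun t _ ↦ hη01 t
  · convert! hγ using 1
    rw [← A a haa', ← B b hb'b]
    apply pathELength_comp_of_monotoneOn hab.le
    · apply Monotone.monotoneOn
      apply Real.smoothTransition.monotone.comp
      intro t u htu
      dsimp only
      gcongr
    · simp only [η]
      apply (ContDiff.contDiffOn (n := 1) _).differentiableOn one_ne_zero
      fun_prop
    · rw [A a haa', B b hb'b]
      exact γ_smooth.mdifferentiableOn (by simp)
  · filter_upwards [Iio_mem_nhds haa'] with t ht using A' t ht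
  · filter_upwards [Ioi_mem_nhds hb'b] with t ht using B' t ht

lemma innerDist_self (hx : x ∈ U) : innerDist U x x = 0 := by
  have := innerDist_le_pathELength (U := U) (γ := fun _ : ℝ ↦ x) (le_refl (0 : ℝ))
    contMDiffOn_const (fun _ _ ↦ hx)
  simpa using this

lemma innerDist_comm (U : Set X) (x y : X) : innerDist U x y = innerDist U y x := by
  suffices H : ∀ x y, innerDist U y x ≤ innerDist U x y from le_antisymm (H y x) (H x y)
  intro x y
  refine le_of_forall_gt (fun c hc ↦ ?_)
  obtain ⟨γ, γ0, γ1, hγ, hU, hlen, -⟩ := exists_locally_constant_path_of_innerDist_lt hc zero_lt_one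
  let η : ℝ → ℝ := fun t ↦ -t
  have hs : ContMDiff 𝓘(ℝ, ℝ) (𝓡 2) ∞ (γ ∘ η) := hγ.comp (contDiff_neg.contMDiff)
  have h1 := innerDist_le_pathELength (U := U) (γ := γ ∘ η) (a := η 1) (b := η 0)
    (by simp [η]) hs.contMDiffOn (fun t _ ↦ hU _)
  rw [← pathELength_comp_of_antitoneOn zero_le_one] at h1; rotate_left
  · exact monotone_id.neg.antitoneOn _
  · exact differentiableOn_neg _
  · exact hs.contMDiffOn.mdifferentiableOn (by simp)
  have e : (γ ∘ η) ∘ η = γ := by ext t; simp [η]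
  rw [e] at h1
  simp only [Function.comp_apply, η, neg_neg, γ0, γ1] at h1
  exact h1.trans_lt hlen

lemma innerDist_triangle (U : Set X) (x y z : X) :
    innerDist U x z ≤ innerDist U x y + innerDist U y z := by
  refine le_of_forall_gt (fun r hr ↦ ?_)
  rcases ENNReal.exists_add_lt_of_add_lt hr with ⟨u, hu, v, hv, huv⟩
  rcases exists_locally_constant_path_of_innerDist_lt hu zero_lt_one with
    ⟨γ₁, hγ₁0, hγ₁1, hγ₁_smooth, hU₁, hγ₁, -, hγ₁_const⟩
  rcases exists_locally_constant_path_of_innerDist_lt hv one_lt_two with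
    ⟨γ₂, hγ₂1, hγ₂2, hγ₂_smooth, hU₂, hγ₂, hγ₂_const, -⟩
  let γ := piecewise (Iic 1) γ₁ γ₂
  have h0 : γ 0 = x := by simp [γ, hγ₁0]
  have h2 : γ 2 = z := by simp [γ, hγ₂2]
  have : innerDist U x z ≤ pathELength (𝓡 2) γ 0 2 := by
    rw [← h0, ← h2]
    apply innerDist_le_pathELength zero_le_two
    · apply ContMDiff.contMDiffOn
      exact ContMDiff.piecewise_Iic hγ₁_smooth hγ₂_smooth (hγ₁_const.trans hγ₂_const.symm)
    · intro t _
      by_cases ht : t ≤ 1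
      · simpa [γ, ht] using hU₁ t
      · simpa [γ, ht] using hU₂ t
  apply this.trans_lt (lt_trans ?_ huv)
  rw [← pathELength_add zero_le_one one_le_two]
  gcongr
  · convert! hγ₁ using 1
    apply pathELength_congr
    intro t ht
    simp [γ, ht.2]
  · convert! hγ₂ using 1
    apply pathELength_congr_Ioo
    intro t ht
    simp [γ, ht.1]

lemma riemannianEDist_le_innerDist : riemannianEDist (𝓡 2) x y ≤ innerDist U x y := by
  refine le_of_forall_gt (fun c hc ↦ ?_)
  obtain ⟨γ, hγ, -, h0, h1, hlen⟩ := exists_path_of_innerDist_lt hc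
  exact (riemannianEDist_le_pathELength (hγ.of_le (by simp)) h0 h1 zero_le_one).trans_lt hlen

/-- A path of length `< c` in `U`, together with its continuous length function `ℓ`. -/
lemma exists_path_length_of_innerDist_lt {c : ℝ≥0∞} (h : innerDist U x y < c) :
    ∃ (γ : ℝ → X) (ℓ : ℝ → ℝ), ContinuousOn γ (Icc 0 1) ∧ MapsTo γ (Icc 0 1) U ∧
      γ 0 = x ∧ γ 1 = y ∧ ContinuousOn ℓ (Icc 0 1) ∧ ℓ 0 = 0 ∧ 0 ≤ ℓ 1 ∧
      ENNReal.ofReal (ℓ 1) < c ∧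
      ∀ s ∈ Icc (0 : ℝ) 1, ∀ t ∈ Icc (0 : ℝ) 1, s ≤ t →
        innerDist U (γ s) (γ t) ≤ ENNReal.ofReal (ℓ t - ℓ s) := by
  obtain ⟨γ, hγ, hU, h0, h1, hlen⟩ := exists_path_of_innerDist_lt h
  have hfin : ∀ s ∈ Icc (0 : ℝ) 1, ∀ t ∈ Icc (0 : ℝ) 1, pathELength (𝓡 2) γ s t ≠ ⊤ :=
    fun s hs t ht ↦ ((pathELength_mono hs.1 ht.2).trans_lt (hlen.trans_le le_top)).ne
  have m0 : (0 : ℝ) ∈ Icc (0 : ℝ) 1 := by simp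
  have m1 : (1 : ℝ) ∈ Icc (0 : ℝ) 1 := by simp
  have hdiff : ∀ s ∈ Icc (0 : ℝ) 1, ∀ t ∈ Icc (0 : ℝ) 1, s ≤ t →
      (pathELength (𝓡 2) γ 0 t).toReal - (pathELength (𝓡 2) γ 0 s).toReal =
        (pathELength (𝓡 2) γ s t).toReal := fun s hs t ht hst ↦ by
    rw [← pathELength_add hs.1 hst, ENNReal.toReal_add (hfin _ m0 _ hs) (hfin _ hs _ ht)]
    ring
  refine ⟨γ, fun t ↦ (pathELength (𝓡 2) γ 0 t).toReal, hγ.continuousOn, hU, h0, h1, ?_, by simp,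
    ENNReal.toReal_nonneg, by rwa [ENNReal.ofReal_toReal (hfin _ m0 _ m1)],
    fun s hs t ht hst ↦ ?_⟩
  · -- absolute continuity of the integral defining the length
    rw [Metric.continuousOn_iff]
    intro t ht ε hε
    obtain ⟨δ, hδ, hδε⟩ := MeasureTheory.exists_pos_setLIntegral_lt_of_measure_lt
      (μ := MeasureTheory.volume.restrict (Icc (0 : ℝ) 1))
      (f := fun t ↦ ‖mfderiv 𝓘(ℝ, ℝ) (𝓡 2) γ t (1 : ℝ)‖ₑ)
      (by have := hfin _ m0 _ m1; rwa [pathELength_eq_lintegral_mfderiv_Icc] at this)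
      (ε := ENNReal.ofReal ε) (by simpa using hε)
    have key : ∀ s ∈ Icc (0 : ℝ) 1, ∀ t ∈ Icc (0 : ℝ) 1, s ≤ t → ENNReal.ofReal (t - s) < δ →
        (pathELength (𝓡 2) γ s t).toReal < ε := fun s hs t ht hst hlt ↦ by
      rw [← ENNReal.ofReal_lt_ofReal_iff hε, ENNReal.ofReal_toReal (hfin _ hs _ ht)]
      have h2 := hδε (Icc s t) (by
        refine (MeasureTheory.Measure.restrict_apply_le _ _).trans_lt ?_
        rwa [Real.volume_Icc])
      rw [MeasureTheory.Measure.restrict_restrict measurableSet_Icc,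
        inter_eq_left.2 (Icc_subset_Icc hs.1 ht.2)] at h2
      rw [pathELength_eq_lintegral_mfderiv_Icc]
      exact h2
    obtain ⟨d, hd, hdδ⟩ : ∃ d > 0, ENNReal.ofReal d ≤ δ := by
      rcases eq_or_ne δ ⊤ with rfl | hδt
      · exact ⟨1, one_pos, le_top⟩
      · exact ⟨δ.toReal, ENNReal.toReal_pos hδ.ne' hδt, (ENNReal.ofReal_toReal hδt).le⟩
    refine ⟨d, hd, fun s hs hst ↦ ?_⟩
    have hlt : ∀ e < d, ENNReal.ofReal e < δ := fun e he ↦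
      ((ENNReal.ofReal_lt_ofReal_iff hd).2 he).trans_le hdδ
    rw [Real.dist_eq] at hst ⊢
    rcases le_total s t with h' | h'
    · rw [abs_sub_comm, hdiff s hs t ht h', abs_of_nonneg ENNReal.toReal_nonneg]
      exact key s hs t ht h' (hlt _ (by
        rw [abs_sub_comm] at hst
        exact (le_abs_self _).trans_lt hst))
    · rw [hdiff t ht s hs h', abs_of_nonneg ENNReal.toReal_nonneg]
      exact key t ht s hs h' (hlt _ ((le_abs_self _).trans_lt hst))
  · rw [hdiff s hs t ht hst, ENNReal.ofReal_toReal (hfin _ hs _ ht)]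
    exact innerDist_le_pathELength hst (hγ.mono (Icc_subset_Icc hs.1 ht.2))
      (hU.mono_left (Icc_subset_Icc hs.1 ht.2))

variable [IsManifold (𝓡 2) ∞ X]
    [IsContMDiffRiemannianBundle (𝓡 2) ∞ (EuclideanSpace ℝ (Fin 2))
      (fun x : X ↦ TangentSpace (𝓡 2) x)]

variable (X) in
lemma isContinuousRiemannianBundle_tangent : IsContinuousRiemannianBundle
    (EuclideanSpace ℝ (Fin 2)) (fun x : X ↦ TangentSpace (𝓡 2) x) := by
  obtain ⟨g, hg, h⟩ := IsContMDiffRiemannianBundle.exists_contMDiff (IB := 𝓡 2) (n := ∞)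
    (F := EuclideanSpace ℝ (Fin 2)) (E := fun x : X ↦ TangentSpace (𝓡 2) x)
  exact ⟨g, hg.continuous, h⟩

/-- Near `z`, the derivative of the inverse of the chart at `z` is bounded. -/
lemma eventually_enorm_mfderivWithin_symm_extChartAt_apply_le (z : X) :
    ∃ C : ℝ≥0, 0 < C ∧ ∀ᶠ y in 𝓝 (extChartAt (𝓡 2) z z), ∀ v : EuclideanSpace ℝ (Fin 2),
      ‖mfderivWithin 𝓘(ℝ, EuclideanSpace ℝ (Fin 2)) (𝓡 2) (extChartAt (𝓡 2) z).symm
        (range (𝓡 2)) y v‖ₑ ≤ C * ‖v‖ₑ := by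
  have := isContinuousRiemannianBundle_tangent X
  have : IsManifold (𝓡 2) 1 X := IsManifold.of_le (n := ∞) (by simp)
  obtain ⟨C, C_pos, hC⟩ := eventually_enorm_mfderivWithin_symm_extChartAt_lt (𝓡 2) z
  refine ⟨C, C_pos, ?_⟩
  have h : 𝓝[range (𝓡 2)] (extChartAt (𝓡 2) z z) = 𝓝 (extChartAt (𝓡 2) z z) := by simp
  rw [h] at hC
  filter_upwards [hC] with y hy v
  exact (ContinuousLinearMap.le_opENorm (E := EuclideanSpace ℝ (Fin 2))
    (F := TangentSpace (𝓡 2) ((extChartAt (𝓡 2) z).symm y)) _ v).trans (mul_le_mul_left hy.le _)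

/-- Near `z`, the inverse of the chart at `z` is Lipschitz for the lengths of smooth paths. -/
lemma exists_innerDist_le_of_chart_path (z : X) :
    ∃ C : ℝ≥0, 0 < C ∧ ∃ r > 0, Metric.ball (extChartAt (𝓡 2) z z) r ⊆ (extChartAt (𝓡 2) z).target ∧
      ∀ (η : ℝ → EuclideanSpace ℝ (Fin 2)) (K : ℝ≥0) (U : Set X), ContDiffOn ℝ ∞ η (Icc 0 1) →
        MapsTo η (Icc 0 1) (Metric.ball (extChartAt (𝓡 2) z z) r) →
        (∀ t ∈ Icc (0 : ℝ) 1, ‖derivWithin η (Icc 0 1) t‖₊ ≤ K) →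
        (∀ t ∈ Icc (0 : ℝ) 1, (extChartAt (𝓡 2) z).symm (η t) ∈ U) →
        innerDist U ((extChartAt (𝓡 2) z).symm (η 0)) ((extChartAt (𝓡 2) z).symm (η 1)) ≤ C * K := by
  obtain ⟨C, C_pos, hC⟩ := eventually_enorm_mfderivWithin_symm_extChartAt_apply_le z
  obtain ⟨r, r_pos, hr'⟩ := Metric.mem_nhds_iff.1 (inter_mem (extChartAt_target_mem_nhds z) hC)
  refine ⟨C, C_pos, r, r_pos, fun y hy ↦ (hr' hy).1, fun η K U hη hball hK hU ↦ ?_⟩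
  have ηs : ContMDiffOn 𝓘(ℝ, ℝ) 𝓘(ℝ, EuclideanSpace ℝ (Fin 2)) ∞ η (Icc 0 1) := hη.contMDiffOn
  have hs : ContMDiffOn 𝓘(ℝ, ℝ) (𝓡 2) ∞ ((extChartAt (𝓡 2) z).symm ∘ η) (Icc 0 1) :=
    (contMDiffOn_extChartAt_symm z).comp ηs (fun t ht ↦ (hr' (hball ht)).1)
  refine (innerDist_le_pathELength (U := U) zero_le_one hs hU).trans ?_
  rw [pathELength_eq_lintegral_mfderivWithin_Icc]
  have hle : ∀ t ∈ Icc (0 : ℝ) 1, ‖mfderivWithin 𝓘(ℝ, ℝ) (𝓡 2) ((extChartAt (𝓡 2) z).symm ∘ η)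
      (Icc 0 1) t (1 : ℝ)‖ₑ ≤ C * K := fun t ht ↦ by
    have e : mfderivWithin 𝓘(ℝ, ℝ) (𝓡 2) ((extChartAt (𝓡 2) z).symm ∘ η) (Icc 0 1) t =
        (mfderivWithin 𝓘(ℝ, EuclideanSpace ℝ (Fin 2)) (𝓡 2) (extChartAt (𝓡 2) z).symm
          (range (𝓡 2)) (η t)) ∘L
        (mfderivWithin 𝓘(ℝ, ℝ) 𝓘(ℝ, EuclideanSpace ℝ (Fin 2)) η (Icc 0 1) t) := by
      apply mfderivWithin_comp
      · exact mdifferentiableWithinAt_extChartAt_symm (hr' (hball ht)).1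
      · exact ηs.mdifferentiableOn (by simp) t ht
      · intro s _; simp
      · rw [uniqueMDiffWithinAt_iff_uniqueDiffWithinAt]
        exact uniqueDiffOn_Icc zero_lt_one t ht
    have e1 : mfderivWithin 𝓘(ℝ, ℝ) (𝓡 2) ((extChartAt (𝓡 2) z).symm ∘ η) (Icc 0 1) t (1 : ℝ) =
        (mfderivWithin 𝓘(ℝ, EuclideanSpace ℝ (Fin 2)) (𝓡 2) (extChartAt (𝓡 2) z).symm
          (range (𝓡 2)) (η t))
        (mfderivWithin 𝓘(ℝ, ℝ) 𝓘(ℝ, EuclideanSpace ℝ (Fin 2)) η (Icc 0 1) t (1 : ℝ)) :=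
      congr($e (1 : ℝ))
    rw [e1]
    refine ((hr' (hball ht)).2 _).trans ?_
    gcongr
    have := hK t ht
    rw [← fderivWithin_derivWithin] at this
    rw [mfderivWithin_eq_fderivWithin]
    exact ENNReal.coe_le_coe.2 this
  refine (MeasureTheory.setLIntegral_mono' measurableSet_Icc hle).trans ?_
  simp

/-- `innerDist U` tends to zero at each point of the open set `U`. -/
lemma eventually_innerDist_lt (hU : IsOpen U) (hz : z ∈ U) {ε : ℝ≥0∞} (hε : 0 < ε) :
    ∀ᶠ y in 𝓝 z, innerDist U z y < ε := by
  obtain ⟨C, hC, r, hr, hball, H⟩ := exists_innerDist_le_of_chart_path z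
  set ψ := extChartAt (𝓡 2) z with hψ
  have hsymm : ContinuousAt ψ.symm (ψ z) := continuousAt_extChartAt_symm z
  obtain ⟨r', hr', hr'U⟩ : ∃ r' > 0, Metric.ball (ψ z) r' ⊆ ψ.symm ⁻¹' U :=
    Metric.mem_nhds_iff.1 (hsymm.preimage_mem_nhds (by
      rw [hψ, extChartAt_to_inv]; exact hU.mem_nhds hz))
  have hcont : ContinuousAt ψ z := continuousAt_extChartAt z
  have h1 : ∀ᶠ y in 𝓝 z, ψ y ∈ Metric.ball (ψ z) (min r r') :=
    hcont.preimage_mem_nhds (Metric.ball_mem_nhds _ (lt_min hr hr'))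
  have h2 : ∀ᶠ y in 𝓝 z, (C : ℝ≥0∞) * ‖ψ y - ψ z‖₊ < ε := by
    have ht : Tendsto (fun y ↦ (C : ℝ≥0∞) * ‖ψ y - ψ z‖₊) (𝓝 z) (𝓝 0) := by
      have : Tendsto (fun y ↦ ((C * ‖ψ y - ψ z‖₊ : ℝ≥0) : ℝ≥0∞)) (𝓝 z) (𝓝 ((0 : ℝ≥0) : ℝ≥0∞)) := by
        rw [ENNReal.tendsto_coe]
        have h3 : Tendsto (fun y ↦ C * ‖ψ y - ψ z‖₊) (𝓝 z) (𝓝 (C * ‖ψ z - ψ z‖₊)) :=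
          ((hcont.tendsto.sub_const _).nnnorm).const_mul _
        simpa using h3
      simpa using this
    exact ht.eventually_lt_const hε
  filter_upwards [h1, h2, extChartAt_source_mem_nhds (I := 𝓡 2) z] with y hy1 hy2 hy3
  let η : ℝ → EuclideanSpace ℝ (Fin 2) := fun t ↦ ψ z + t • (ψ y - ψ z)
  have hη : ContDiff ℝ ∞ η := by fun_prop
  have hd : ∀ t ∈ Icc (0 : ℝ) 1, derivWithin η (Icc 0 1) t = ψ y - ψ z := fun t ht ↦ by
    have : HasDerivAt η ((1 : ℝ) • (ψ y - ψ z)) t :=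
      ((hasDerivAt_id t).smul_const (ψ y - ψ z)).const_add (ψ z)
    rw [one_smul] at this
    exact this.hasDerivWithinAt.derivWithin (uniqueDiffOn_Icc zero_lt_one t ht)
  have hmem : ∀ t ∈ Icc (0 : ℝ) 1, η t ∈ Metric.ball (ψ z) (min r r') := fun t ht ↦ by
    have h4 : ‖ψ y - ψ z‖ < min r r' := by simpa [dist_eq_norm] using hy1
    have h5 : ‖t • (ψ y - ψ z)‖ ≤ 1 * ‖ψ y - ψ z‖ := by
      rw [norm_smul, Real.norm_of_nonneg ht.1]
      exact mul_le_mul_of_nonneg_right ht.2 (norm_nonneg _)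
    simp only [η, Metric.mem_ball, dist_eq_norm, add_sub_cancel_left]
    linarith
  have := H η ‖ψ y - ψ z‖₊ U hη.contDiffOn
    (fun t ht ↦ Metric.ball_subset_ball (min_le_left _ _) (hmem t ht))
    (fun t ht ↦ by rw [hd t ht])
    (fun t ht ↦ hr'U (Metric.ball_subset_ball (min_le_right _ _) (hmem t ht)))
  have e0 : ψ.symm (η 0) = z := by simp [η, hψ]
  have e1 : ψ.symm (η 1) = y := by
    simp only [η, one_smul, add_sub_cancel]
    exact ψ.left_inv hy3
  rw [e0, e1] at this
  exact this.trans_lt hy2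

end InnerDist

/-! ### Interior and boundary charts -/

section Charts

variable {X : Type*} [TopologicalSpace X] {Y : Set X} {x y z : X}

lemma interiorPts_subset : interiorPts Y ⊆ Y := fun _ ⟨_, hs, he, hpos⟩ ↦ (he _ hs).2 hpos.le

lemma mem_interiorPts_or_mem_boundaryPts (hY : IsC0Submanifold Y) (hy : y ∈ Y) :
    y ∈ interiorPts Y ∨ y ∈ boundaryPts Y := by
  obtain ⟨e, hs, he⟩ := hY y hy
  rcases ((he y hs).1 hy).eq_or_lt with h | h
  · exact Or.inr ⟨e, hs, he, h.symm⟩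
  · exact Or.inl ⟨e, hs, he, h⟩

lemma boundaryPts_subset : boundaryPts Y ⊆ Y := fun _ ⟨_, hs, he, h0⟩ ↦ (he _ hs).2 h0.ge

lemma isOpen_interiorPts : IsOpen (interiorPts Y) := by
  refine isOpen_iff_mem_nhds.2 (fun y ⟨e, hs, he, hpos⟩ ↦ ?_)
  have h1 : ContinuousAt (fun x ↦ e x 0) y :=
    ((EuclideanSpace.proj (𝕜 := ℝ) (0 : Fin 2)).continuous.continuousAt).comp (e.continuousAt hs)
  filter_upwards [e.open_source.mem_nhds hs, h1.eventually_const_lt hpos] with x hx hx'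
  exact ⟨e, hx, he, hx'⟩

/-- `E` is a complex-valued chart around `z`, centred at `z`, that identifies `Y` with the
half-plane `0 ≤ re`. -/
structure IsBoundaryChart (Y : Set X) (z : X) (E : OpenPartialHomeomorph X ℂ) : Prop where
  mem_source : z ∈ E.source
  map_eq_zero : E z = 0
  mem_iff : ∀ x ∈ E.source, x ∈ Y ↔ 0 ≤ (E x).re

lemma exists_isBoundaryChart (hz : z ∈ boundaryPts Y) : ∃ E, IsBoundaryChart Y z E := by
  obtain ⟨e, hs, he, h0⟩ := hz
  let J := Complex.orthonormalBasisOneI.repr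
  have hJ : ∀ p : EuclideanSpace ℝ (Fin 2), (J.symm p).re = p 0 := fun p ↦ by
    have : J (J.symm p) 0 = (J.symm p).re := by
      simp only [J, Complex.orthonormalBasisOneI_repr_apply]; rfl
    rw [← this, J.apply_symm_apply]
  refine ⟨e.transHomeomorph ((Homeomorph.subRight (e z)).trans J.symm.toHomeomorph),
    by simpa using hs, ?_, fun x hx ↦ ?_⟩
  · simp
  · have hx' : x ∈ e.source := by simpa using hx
    rw [he x hx']
    simp [hJ, h0]

namespace IsBoundaryChart

variable {E : OpenPartialHomeomorph X ℂ}

lemma symm_zero (hE : IsBoundaryChart Y z E) : E.symm 0 = z := by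
  rw [← hE.map_eq_zero, E.left_inv hE.mem_source]

lemma zero_mem_target (hE : IsBoundaryChart Y z E) : (0 : ℂ) ∈ E.target := by
  rw [← hE.map_eq_zero]; exact E.map_source hE.mem_source

lemma mem_interiorPts (hE : IsBoundaryChart Y z E) (hx : x ∈ E.source) (hre : 0 < (E x).re) :
    x ∈ interiorPts Y := by
  let J := Complex.orthonormalBasisOneI.repr
  have hJ : ∀ p : ℂ, J p 0 = p.re := fun p ↦ by
    simp only [J, Complex.orthonormalBasisOneI_repr_apply]; rfl
  exact ⟨E.transHomeomorph J.toHomeomorph, by simpa using hx,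
    fun y hy ↦ by
      have hy' : y ∈ E.source := by simpa using hy
      rw [hE.mem_iff y hy']; simp [hJ], by simpa [hJ] using hre⟩

lemma mem_boundaryPts (hE : IsBoundaryChart Y z E) (hx : x ∈ E.source) (hre : (E x).re = 0) :
    x ∈ boundaryPts Y := by
  let J := Complex.orthonormalBasisOneI.repr
  have hJ : ∀ p : ℂ, J p 0 = p.re := fun p ↦ by
    simp only [J, Complex.orthonormalBasisOneI_repr_apply]; rfl
  exact ⟨E.transHomeomorph J.toHomeomorph, by simpa using hx,
    fun y hy ↦ by
      have hy' : y ∈ E.source := by simpa using hy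
      rw [hE.mem_iff y hy']; simp [hJ], by simpa [hJ] using hre⟩

/-- Interior points of `Y` have positive real part in every boundary chart: a neighbourhood of a
point with real part zero contains points with negative real part, which are not in `Y`. -/
lemma re_pos (hE : IsBoundaryChart Y z E) (hx : x ∈ E.source) (hxY : x ∈ interiorPts Y) :
    0 < (E x).re := by
  refine ((hE.mem_iff x hx).1 (interiorPts_subset hxY)).lt_of_ne (fun h0 ↦ ?_)
  have h1 : E.symm ⁻¹' interiorPts Y ∩ E.target ∈ 𝓝 (E x) := by
    refine inter_mem ?_ (E.open_target.mem_nhds (E.map_source hx))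
    refine (E.continuousAt_symm (E.map_source hx)).preimage_mem_nhds ?_
    rw [E.left_inv hx]; exact isOpen_interiorPts.mem_nhds hxY
  obtain ⟨ε, hε, hball⟩ := Metric.mem_nhds_iff.1 h1
  obtain ⟨h2, h3⟩ := hball (show E x - (ε / 2 : ℝ) ∈ Metric.ball (E x) ε by
    simp [abs_of_pos hε, hε])
  have h4 := (hE.mem_iff _ (E.map_target h3)).1 (interiorPts_subset h2)
  rw [E.right_inv h3] at h4
  simp only [Complex.sub_re, ← h0, Complex.ofReal_re] at h4
  linarith

lemma exists_radius (hE : IsBoundaryChart Y z E) {N : Set X} (hN : N ∈ 𝓝 z) :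
    ∃ r > 0, Metric.closedBall 0 r ⊆ E.target ∧ ∀ p ∈ Metric.closedBall (0 : ℂ) r, E.symm p ∈ N := by
  have h1 : E.symm ⁻¹' N ∩ E.target ∈ 𝓝 (0 : ℂ) := by
    refine inter_mem ?_ (E.open_target.mem_nhds hE.zero_mem_target)
    refine (E.continuousAt_symm hE.zero_mem_target).preimage_mem_nhds ?_
    rwa [hE.symm_zero]
  obtain ⟨r, hr, h⟩ := Metric.nhds_basis_closedBall.mem_iff.1 h1
  exact ⟨r, hr, fun p hp ↦ (h hp).2, fun p hp ↦ (h hp).1⟩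

lemma halfDisc_mem_nhds (hE : IsBoundaryChart Y z E) {r : ℝ} (hr : 0 < r) :
    {x | x ∈ E.source ∧ ‖E x‖ < r} ∈ 𝓝 z := by
  refine inter_mem (E.open_source.mem_nhds hE.mem_source) ?_
  have h1 : Tendsto (fun x ↦ ‖E x‖) (𝓝 z) (𝓝 ‖E z‖) := (E.continuousAt hE.mem_source).norm
  rw [hE.map_eq_zero, norm_zero] at h1
  exact h1.eventually_lt_const hr

end IsBoundaryChart

/-- A path that starts outside a closed disc of the chart `E` and ends inside it has a terminal
part that runs in this disc and starts on its boundary circle. -/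
lemma exists_terminal_path [T2Space X] {E : OpenPartialHomeomorph X ℂ} {γ : ℝ → X}
    (hγ : ContinuousOn γ (Icc 0 1)) {r : ℝ} (hr : Metric.closedBall 0 r ⊆ E.target)
    (h0 : ¬ (γ 0 ∈ E.source ∧ ‖E (γ 0)‖ < r)) (h1 : γ 1 ∈ E.source) (h1' : ‖E (γ 1)‖ < r) :
    ∃ τ : ℝ → ℝ, MapsTo τ (Icc 0 1) (Icc 0 1) ∧ StrictMono τ ∧ τ 1 = 1 ∧
      (∀ t ∈ Icc (0 : ℝ) 1, γ (τ t) ∈ E.source ∧ ‖E (γ (τ t))‖ ≤ r) ∧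
      ContinuousOn (fun t ↦ E (γ (τ t))) (Icc 0 1) ∧ ‖E (γ (τ 0))‖ = r := by
  let W : Set X := E.source ∩ E ⁻¹' Metric.ball 0 r
  have hW : ∀ x, x ∈ W ↔ x ∈ E.source ∧ ‖E x‖ < r := fun x ↦ by simp [W]
  have hWo : IsOpen W := E.isOpen_inter_preimage Metric.isOpen_ball
  have hScl : IsClosed (Icc 0 1 ∩ γ ⁻¹' Wᶜ) :=
    hγ.preimage_isClosed_of_isClosed isClosed_Icc hWo.isClosed_compl
  have hSc : IsCompact (Icc 0 1 ∩ γ ⁻¹' Wᶜ) :=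
    isCompact_Icc.of_isClosed_subset hScl inter_subset_left
  obtain ⟨t₀, ⟨ht₀, ht₀W⟩, hmax⟩ := hSc.exists_isGreatest ⟨0, by simp, fun h ↦ h0 ((hW _).1 h)⟩
  have ht₀1 : t₀ < 1 := lt_of_le_of_ne ht₀.2 (fun h ↦ ht₀W (by
    rw [h]; exact (hW _).2 ⟨h1, h1'⟩))
  have hin : ∀ t ∈ Ioc t₀ 1, γ t ∈ W := fun t ht ↦ by
    by_contra hcon
    exact absurd (hmax ⟨⟨ht₀.1.trans ht.1.le, ht.2⟩, hcon⟩) (not_le.2 ht.1)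
  -- by compactness of the closed disc the exit point lies in it
  have hKc : IsClosed (E.symm '' Metric.closedBall 0 r) :=
    ((isCompact_closedBall (0 : ℂ) r).image_of_continuousOn
      (E.continuousOn_symm.mono hr)).isClosed
  have ht₀K : γ t₀ ∈ E.symm '' Metric.closedBall 0 r := by
    have hc : ContinuousWithinAt γ (Ioc t₀ 1) t₀ :=
      (hγ t₀ ht₀).mono (fun t ht ↦ ⟨ht₀.1.trans ht.1.le, ht.2⟩)
    refine hKc.closure_subset (hc.mem_closure ?_ (fun t ht ↦ ?_))
    · rw [closure_Ioc ht₀1.ne]; exact ⟨le_rfl, ht₀1.le⟩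
    · obtain ⟨hs, hn⟩ := (hW _).1 (hin t ht)
      exact ⟨E (γ t), by simpa using hn.le, E.left_inv hs⟩
  obtain ⟨p, hp, hpt⟩ := ht₀K
  have hs₀ : γ t₀ ∈ E.source := hpt ▸ E.map_target (hr hp)
  have hp' : E (γ t₀) = p := by rw [← hpt, E.right_inv (hr hp)]
  have hall : ∀ t ∈ Icc t₀ 1, γ t ∈ E.source ∧ ‖E (γ t)‖ ≤ r := fun t ht ↦ by
    rcases ht.1.eq_or_lt with h | h
    · subst h; exact ⟨hs₀, by rw [hp']; simpa using hp⟩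
    · obtain ⟨a, b⟩ := (hW _).1 (hin t ⟨h, ht.2⟩); exact ⟨a, b.le⟩
  let τ : ℝ → ℝ := fun t ↦ t₀ + t * (1 - t₀)
  have hτ : MapsTo τ (Icc 0 1) (Icc t₀ 1) := fun t ht ↦ by
    have h1 : 0 ≤ t * (1 - t₀) := mul_nonneg ht.1 (by linarith)
    have h2 : t * (1 - t₀) ≤ 1 * (1 - t₀) := mul_le_mul_of_nonneg_right ht.2 (by linarith)
    exact ⟨by simp only [τ]; linarith, by simp only [τ]; linarith⟩
  refine ⟨τ, fun t ht ↦ Icc_subset_Icc_left ht₀.1 (hτ ht), ?_, by simp [τ],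
    fun t ht ↦ hall _ (hτ ht), ?_, ?_⟩
  · intro s t hst
    have : s * (1 - t₀) < t * (1 - t₀) := mul_lt_mul_of_pos_right hst (by linarith)
    simp only [τ]; linarith
  · refine E.continuousOn.comp (hγ.comp (by fun_prop) (fun t ht ↦
      Icc_subset_Icc_left ht₀.1 (hτ ht))) (fun t ht ↦ (hall _ (hτ ht)).1)
  · have : τ 0 = t₀ := by simp [τ]
    rw [this]
    refine le_antisymm (hall _ ⟨le_rfl, ht₀1.le⟩).2 (not_lt.1 fun h ↦ ht₀W ((hW _).2 ⟨hs₀, h⟩))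

lemma interiorPts_disjoint_boundaryPts : Disjoint (interiorPts Y) (boundaryPts Y) := by
  rw [Set.disjoint_left]
  intro y hy hy'
  obtain ⟨E, hE⟩ := exists_isBoundaryChart hy'
  have := hE.re_pos hE.mem_source hy
  simp [hE.map_eq_zero] at this

lemma IsC0Submanifold.subset_closure_interiorPts (hY : IsC0Submanifold Y) :
    Y ⊆ closure (interiorPts Y) := fun y hy ↦ by
  rcases mem_interiorPts_or_mem_boundaryPts hY hy with h | h
  · exact subset_closure h
  obtain ⟨E, hE⟩ := exists_isBoundaryChart h
  rw [mem_closure_iff_nhds]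
  intro N hN
  obtain ⟨r, hr, hrt, hrN⟩ := hE.exists_radius hN
  have hp : ((r : ℝ) : ℂ) ∈ Metric.closedBall (0 : ℂ) r := by simp [abs_of_pos hr]
  exact ⟨E.symm r, hrN _ hp, hE.mem_interiorPts (E.map_target (hrt hp))
    (by rw [E.right_inv (hrt hp)]; simpa using hr)⟩

end Charts

/-! ### The distance `rho` -/

section Rho

variable {X : Type*} [TopologicalSpace X] [ChartedSpace (EuclideanSpace ℝ (Fin 2)) X]
  [RiemannianBundle (fun x : X ↦ TangentSpace (𝓡 2) x)] {Y : Set X} {x y z : X}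

lemma exists_innerDist_lt_of_rho_lt {c : ℝ≥0∞} (h : rho Y x y < c) {S T : Set X} (hS : S ∈ 𝓝 x)
    (hT : T ∈ 𝓝 y) :
    ∃ x' ∈ S ∩ interiorPts Y, ∃ y' ∈ T ∩ interiorPts Y, innerDist (interiorPts Y) x' y' < c := by
  have h1 := frequently_lt_of_liminf_lt (by isBoundedDefault) h
  have h2 : (S ∩ interiorPts Y) ×ˢ (T ∩ interiorPts Y) ∈
      𝓝[interiorPts Y] x ×ˢ 𝓝[interiorPts Y] y :=
    prod_mem_prod (inter_mem (mem_nhdsWithin_of_mem_nhds hS) self_mem_nhdsWithin)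
      (inter_mem (mem_nhdsWithin_of_mem_nhds hT) self_mem_nhdsWithin)
  obtain ⟨⟨x', y'⟩, hlt, hx', hy'⟩ := (h1.and_eventually h2).exists
  exact ⟨x', hx', y', hy', hlt⟩

lemma rho_le_of_forall_nhds {c : ℝ≥0∞}
    (h : ∀ S ∈ 𝓝 x, ∀ T ∈ 𝓝 y, ∃ x' ∈ S ∩ interiorPts Y, ∃ y' ∈ T ∩ interiorPts Y,
      innerDist (interiorPts Y) x' y' ≤ c) : rho Y x y ≤ c := by
  refine liminf_le_of_frequently_le ?_ (by isBoundedDefault)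
  rw [Filter.frequently_iff]
  intro V hV
  obtain ⟨S, hS, T, hT, hST⟩ := mem_prod_iff.1 hV
  obtain ⟨S', hS', hSS⟩ := mem_nhdsWithin_iff_exists_mem_nhds_inter.1 hS
  obtain ⟨T', hT', hTT⟩ := mem_nhdsWithin_iff_exists_mem_nhds_inter.1 hT
  obtain ⟨x', hx', y', hy', hle⟩ := h S' hS' T' hT'
  exact ⟨(x', y'), hST ⟨hSS hx', hTT hy'⟩, hle⟩

lemma rho_le_of_tendsto {ι : Type*} {F : Filter ι} [F.NeBot] {u v : ι → X} {g : ι → ℝ≥0∞}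
    {c : ℝ≥0∞} (hu : Tendsto u F (𝓝 x)) (hv : Tendsto v F (𝓝 y))
    (huU : ∀ i, u i ∈ interiorPts Y) (hvU : ∀ i, v i ∈ interiorPts Y) (hg : Tendsto g F (𝓝 c))
    (hle : ∀ i, innerDist (interiorPts Y) (u i) (v i) ≤ g i) : rho Y x y ≤ c := by
  refine le_of_forall_gt_imp_ge_of_dense (fun c' hc' ↦ rho_le_of_forall_nhds fun S hS T hT ↦ ?_)
  obtain ⟨i, hi1, hi2, hi3⟩ :=
    ((hu.eventually_mem hS).and ((hv.eventually_mem hT).and (hg.eventually_lt_const hc'))).exists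
  exact ⟨u i, ⟨hi1, huU i⟩, v i, ⟨hi2, hvU i⟩, (hle i).trans hi3.le⟩

lemma rho_comm (Y : Set X) (x y : X) : rho Y x y = rho Y y x := by
  suffices H : ∀ x y, rho Y y x ≤ rho Y x y from le_antisymm (H y x) (H x y)
  intro x y
  refine le_of_forall_gt_imp_ge_of_dense (fun c hc ↦ rho_le_of_forall_nhds fun S hS T hT ↦ ?_)
  obtain ⟨x', hx', y', hy', h⟩ := exists_innerDist_lt_of_rho_lt hc hT hS
  exact ⟨y', hy', x', hx', by rw [innerDist_comm]; exact h.le⟩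

lemma rho_self (hx : x ∈ closure (interiorPts Y)) : rho Y x x = 0 := by
  refine le_antisymm (rho_le_of_forall_nhds fun S hS T hT ↦ ?_) zero_le
  obtain ⟨x', ⟨hxS, hxT⟩, hxU⟩ := mem_closure_iff_nhds.1 hx _ (inter_mem hS hT)
  exact ⟨x', ⟨hxS, hxU⟩, x', ⟨hxT, hxU⟩, (innerDist_self hxU).le⟩

variable [IsManifold (𝓡 2) ∞ X]
    [IsContMDiffRiemannianBundle (𝓡 2) ∞ (EuclideanSpace ℝ (Fin 2))
      (fun x : X ↦ TangentSpace (𝓡 2) x)]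

lemma riemannianEDist_le_rho : riemannianEDist (𝓡 2) x y ≤ rho Y x y := by
  have := isContinuousRiemannianBundle_tangent X
  have : IsManifold (𝓡 2) 1 X := IsManifold.of_le (n := ∞) (by simp)
  refine ENNReal.le_of_forall_pos_le_add (fun ε hε hfin ↦ ?_)
  have hε3 : (0 : ℝ≥0∞) < ε / 3 := ENNReal.div_pos (by simpa using hε.ne') (by simp)
  obtain ⟨x', hx', y', hy', h⟩ := exists_innerDist_lt_of_rho_lt
    (ENNReal.lt_add_right hfin.ne hε3.ne') (eventually_riemannianEDist_lt (𝓡 2) x hε3)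
    (eventually_riemannianEDist_lt (𝓡 2) y hε3)
  calc riemannianEDist (𝓡 2) x y ≤ riemannianEDist (𝓡 2) x x' + riemannianEDist (𝓡 2) x' y :=
        riemannianEDist_triangle
    _ ≤ riemannianEDist (𝓡 2) x x' + (riemannianEDist (𝓡 2) x' y' + riemannianEDist (𝓡 2) y' y) := by
        gcongr; exact riemannianEDist_triangle
    _ ≤ ε / 3 + ((rho Y x y + ε / 3) + ε / 3) := by
        gcongr
        · exact hx'.1.le
        · exact riemannianEDist_le_innerDist.trans h.le
        · rw [riemannianEDist_comm]; exact hy'.1.le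
    _ = rho Y x y + (ε / 3 + ε / 3 + ε / 3) := by ring
    _ = rho Y x y + ε := by rw [ENNReal.add_thirds]

/-- Two paths in a half-disc around a boundary point, both running from the circular side to points
close to the centre, pass through two points that are joined by a short smooth path in the
interior, namely an arc of a small circle of the smooth chart around the centre. -/
lemma IsBoundaryChart.exists_innerDist_lt {E : OpenPartialHomeomorph X ℂ}
    (hE : IsBoundaryChart Y z E) :
    ∃ r₀ > 0, Metric.closedBall 0 r₀ ⊆ E.target ∧ ∀ r, 0 < r → r ≤ r₀ → ∀ ε : ℝ≥0∞, 0 < ε →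
      ∃ δ > 0, ∀ A B : ℝ → ℂ, ContinuousOn A (Icc 0 1) → ContinuousOn B (Icc 0 1) →
        (∀ t ∈ Icc (0 : ℝ) 1, 0 < (A t).re) → (∀ t ∈ Icc (0 : ℝ) 1, 0 < (B t).re) →
        (∀ t ∈ Icc (0 : ℝ) 1, ‖A t‖ ≤ r) → (∀ t ∈ Icc (0 : ℝ) 1, ‖B t‖ ≤ r) →
        ‖A 0‖ = r → ‖B 0‖ = r → ‖A 1‖ < δ → ‖B 1‖ < δ →
        ∃ v ∈ Icc (0 : ℝ) 1, ∃ w ∈ Icc (0 : ℝ) 1,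
          innerDist (interiorPts Y) (E.symm (A v)) (E.symm (B w)) < ε := by
  obtain ⟨C, hC, R, hR, hball, H⟩ := exists_innerDist_le_of_chart_path z
  set ψ := extChartAt (𝓡 2) z with hψ
  let J := Complex.orthonormalBasisOneI.repr
  obtain ⟨r₀, hr₀, hr₀t, hr₀s⟩ := hE.exists_radius (extChartAt_source_mem_nhds (I := 𝓡 2) z)
  refine ⟨r₀, hr₀, hr₀t, fun r hr hrr ε hε ↦ ?_⟩
  have hsub : Metric.closedBall (0 : ℂ) r ⊆ Metric.closedBall 0 r₀ :=
    Metric.closedBall_subset_closedBall hrr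
  let φ : ℂ → ℂ := fun p ↦ J.symm (ψ (E.symm p) - ψ z)
  have hφc : ContinuousOn φ (Metric.closedBall 0 r) := by
    refine J.symm.continuous.comp_continuousOn (ContinuousOn.sub ?_ continuousOn_const)
    exact (continuousOn_extChartAt z).comp (E.continuousOn_symm.mono (hsub.trans hr₀t))
      (fun p hp ↦ hr₀s p (hsub hp))
  have hφ0 : ∀ p ∈ Metric.closedBall (0 : ℂ) r, p ≠ 0 → φ p ≠ 0 := fun p hp hp0 h ↦ by
    have h1 : ψ (E.symm p) = ψ z := by simpa [φ, sub_eq_zero] using h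
    have h2 := ψ.injOn (hr₀s p (hsub hp)) (mem_extChartAt_source z) h1
    apply hp0
    rw [← E.right_inv (hr₀t (hsub hp)), h2, hE.map_eq_zero]
  have ne_of_re : ∀ p : ℂ, 0 < p.re → p ≠ 0 := fun p hp h ↦ by simp [h] at hp
  -- the radius `s` is smaller than all values of `|φ|` on the circle of radius `r`
  obtain ⟨q, hq, hqmin⟩ := (isCompact_sphere (0 : ℂ) r).exists_isMinOn
    ⟨(r : ℂ), by simp [abs_of_pos hr]⟩ (hφc.mono Metric.sphere_subset_closedBall).norm
  have hm : 0 < ‖φ q‖ := norm_pos_iff.2 (hφ0 q (Metric.sphere_subset_closedBall hq) (by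
    rintro rfl; simp [hr.ne] at hq))
  obtain ⟨d, hd, hdε⟩ : ∃ d : ℝ, 0 < d ∧ (C : ℝ≥0∞) * ENNReal.ofReal d < ε := by
    have ht : Tendsto (fun d : ℝ ↦ (C : ℝ≥0∞) * ENNReal.ofReal d) (𝓝[>] 0) (𝓝 0) := by
      have h1 : Tendsto (fun d : ℝ ↦ ENNReal.ofReal d) (𝓝[>] 0) (𝓝 (ENNReal.ofReal 0)) :=
        (ENNReal.continuous_ofReal.tendsto 0).mono_left nhdsWithin_le_nhds
      have h2 := ENNReal.Tendsto.const_mul h1 (Or.inr (ENNReal.coe_ne_top (r := C)))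
      simpa using h2
    obtain ⟨d, h1, h2⟩ := ((ht.eventually_lt_const hε).and self_mem_nhdsWithin).exists
    exact ⟨d, h2, h1⟩
  have hpi := Real.two_pi_pos
  let s : ℝ := min (‖φ q‖ / 2) (min (R / 2) (d / (2 * Real.pi)))
  have hs : 0 < s := by positivity
  have hs1 : s < ‖φ q‖ := (min_le_left _ _).trans_lt (by linarith)
  have hs2 : s < R := ((min_le_right _ _).trans (min_le_left _ _)).trans_lt (by linarith)
  have hs3 : s * (2 * Real.pi) ≤ d := by
    rw [← le_div_iff₀ hpi]; exact (min_le_right _ _).trans (min_le_right _ _)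
  obtain ⟨δ, hδ, hδs⟩ := Metric.continuousWithinAt_iff.1
    (hφc 0 (by simp [hr.le])) s hs
  refine ⟨δ, hδ, fun A B hA hB hAre hBre hAr hBr hA0 hB0 hA1 hB1 ↦ ?_⟩
  obtain ⟨v, hv, w, hw, θ₀, θ₁, hθ, hφA, hφB, harc⟩ := exists_arc_of_paths (φ := φ) hA hB hAre hBre
    hAr hBr hA0 hB0 hA1 hB1 (hφc.mono fun p hp ↦ by simpa using hp.2)
    (fun p h1 h2 ↦ hφ0 p (by simpa using h2) (ne_of_re p h1)) hs
    (fun p _ h2 ↦ hs1.trans_le (hqmin (by simpa using h2)))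
    (fun p _ h2 h3 ↦ by
      have := hδs (x := p) (by simpa using h2) (by simpa using h3)
      simpa [φ, hE.symm_zero] using this)
  refine ⟨v, hv, w, hw, ?_⟩
  -- the circular arc in the smooth chart
  let c : ℝ → ℂ := fun t ↦ s * Complex.exp ((θ₀ + t * (θ₁ - θ₀) : ℝ) * Complex.I)
  let η : ℝ → EuclideanSpace ℝ (Fin 2) := fun t ↦ ψ z + J (c t)
  have hcd : ∀ t, HasDerivAt c (c t * ((θ₁ - θ₀ : ℝ) * Complex.I)) t := fun t ↦ by
    have h1 : HasDerivAt (fun t : ℝ ↦ θ₀ + t * (θ₁ - θ₀)) (θ₁ - θ₀) t := by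
      simpa using ((hasDerivAt_id t).mul_const (θ₁ - θ₀)).const_add θ₀
    have h2 := ((h1.ofReal_comp.mul_const Complex.I).cexp).const_mul (s : ℂ)
    simpa [c, mul_assoc] using h2
  have hcs : ContDiff ℝ ∞ c := by
    have : ContDiff ℝ ∞ (fun t : ℝ ↦ ((θ₀ + t * (θ₁ - θ₀) : ℝ) : ℂ)) :=
      Complex.ofRealCLM.contDiff.comp
        (contDiff_const.add (contDiff_id.mul contDiff_const))
    exact contDiff_const.mul ((this.mul contDiff_const).cexp)
  have hηs : ContDiff ℝ ∞ η := contDiff_const.add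
    (J.toContinuousLinearEquiv.contDiff.comp hcs)
  have hcn : ∀ t, ‖c t‖ = s := fun t ↦ by
    simp only [c, norm_mul, Complex.norm_exp_ofReal_mul_I, Complex.norm_real,
      Real.norm_of_nonneg hs.le, mul_one]
  have hη' : ∀ t ∈ Icc (0 : ℝ) 1, derivWithin η (Icc 0 1) t =
      J (c t * ((θ₁ - θ₀ : ℝ) * Complex.I)) := fun t ht ↦ by
    have h1 : HasDerivAt (fun t ↦ J (c t)) (J (c t * ((θ₁ - θ₀ : ℝ) * Complex.I))) t :=
      J.toContinuousLinearEquiv.toContinuousLinearMap.hasFDerivAt.comp_hasDerivAt t (hcd t)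
    exact (h1.const_add (ψ z)).hasDerivWithinAt.derivWithin (uniqueDiffOn_Icc zero_lt_one t ht)
  have harc' : ∀ t ∈ Icc (0 : ℝ) 1, ∃ p : ℂ, 0 < p.re ∧ ‖p‖ ≤ r ∧ φ p = c t := fun t ht ↦ by
    refine harc _ ?_
    have h1 := (convex_uIcc θ₀ θ₁) left_mem_uIcc right_mem_uIcc (a := 1 - t) (b := t)
      (by linarith [ht.2]) ht.1 (by ring)
    convert h1 using 1
    simp only [smul_eq_mul]; ring
  have hψφ : ∀ p ∈ Metric.closedBall (0 : ℂ) r, ∀ t, φ p = c t → ψ.symm (η t) = E.symm p :=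
    fun p hp t h ↦ by
      have h1 : η t = ψ (E.symm p) := by simp [η, ← h, φ]
      rw [h1, ψ.left_inv (hr₀s p (hsub hp))]
  have key := H η (Real.toNNReal d) (interiorPts Y) hηs.contDiffOn
    (fun t _ ↦ by simpa [η, hcn] using hs2)
    (fun t ht ↦ by
      rw [hη' t ht, ← NNReal.coe_le_coe, coe_nnnorm, J.norm_map, norm_mul, hcn, norm_mul,
        Complex.norm_I, mul_one, Complex.norm_real, Real.norm_eq_abs, Real.coe_toNNReal _ hd.le]
      exact (mul_le_mul_of_nonneg_left hθ hs.le).trans hs3)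
    (fun t ht ↦ by
      obtain ⟨p, hp1, hp2, hp3⟩ := harc' t ht
      have hp : p ∈ Metric.closedBall (0 : ℂ) r := by simpa using hp2
      rw [hψφ p hp t hp3]
      exact hE.mem_interiorPts (E.map_target (hr₀t (hsub hp)))
        (by rwa [E.right_inv (hr₀t (hsub hp))]))
  rw [hψφ (A v) (by simpa using hAr v hv) 0 (by rw [hφA]; simp [c]),
    hψφ (B w) (by simpa using hBr w hw) 1 (by rw [hφB]; simp [c])] at key
  exact key.trans_lt hdε

end Rho

/-! ### The triangle inequality, shortest paths and concatenation -/

section ShortestPaths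

variable {X : Type*} [TopologicalSpace X] {d : X → X → ℝ≥0∞} {Y : Set X} {α β : X} {γ : ℝ → X}

lemma IsShortestPath.add (h : IsShortestPath d Y α β γ) {s t u : ℝ} (hs : s ∈ Icc (0 : ℝ) 1)
    (ht : t ∈ Icc (0 : ℝ) 1) (hu : u ∈ Icc (0 : ℝ) 1) (hst : s ≤ t) (htu : t ≤ u) :
    d (γ s) (γ u) = d (γ s) (γ t) + d (γ t) (γ u) := by
  rw [h.dist_eq s hs u hu (hst.trans htu), h.dist_eq s hs t ht hst, h.dist_eq t ht u hu htu,
    ← add_mul, ← ENNReal.ofReal_add (by linarith) (by linarith)]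
  congr 2; ring

end ShortestPaths

lemma regularSpace_of_surface (X : Type*) [TopologicalSpace X] [T2Space X]
    [ChartedSpace (EuclideanSpace ℝ (Fin 2)) X] : RegularSpace X := by
  have : LocallyCompactSpace X := ChartedSpace.locallyCompactSpace (EuclideanSpace ℝ (Fin 2)) X
  infer_instance

section Rho

variable {X : Type*} [TopologicalSpace X]
  [ChartedSpace (EuclideanSpace ℝ (Fin 2)) X]
  [RiemannianBundle (fun x : X ↦ TangentSpace (𝓡 2) x)]
  [IsManifold (𝓡 2) ∞ X]
  [IsContMDiffRiemannianBundle (𝓡 2) ∞ (EuclideanSpace ℝ (Fin 2))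
      (fun x : X ↦ TangentSpace (𝓡 2) x)] {Y : Set X} {x y z : X}

lemma rho_triangle_of_mem_interiorPts (hz : z ∈ interiorPts Y) :
    rho Y x y ≤ rho Y x z + rho Y z y := by
  refine ENNReal.le_of_forall_pos_le_add (fun ε hε hfin ↦ rho_le_of_forall_nhds fun S hS T hT ↦ ?_)
  have hε4 : (0 : ℝ≥0∞) < ε / 2 / 2 :=
    ENNReal.div_pos (ENNReal.div_pos (by simpa using hε.ne') (by simp)).ne' (by simp)
  have hN := eventually_innerDist_lt isOpen_interiorPts hz hε4
  obtain ⟨x', hx', z', hz', h1⟩ := exists_innerDist_lt_of_rho_lt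
    (ENNReal.lt_add_right (ENNReal.add_lt_top.1 hfin).1.ne hε4.ne') hS hN
  obtain ⟨z'', hz'', y', hy', h2⟩ := exists_innerDist_lt_of_rho_lt
    (ENNReal.lt_add_right (ENNReal.add_lt_top.1 hfin).2.ne hε4.ne') hN hT
  refine ⟨x', hx', y', hy', ?_⟩
  set D := innerDist (interiorPts Y)
  calc D x' y' ≤ D x' z' + D z' y' := innerDist_triangle _ _ _ _
    _ ≤ D x' z' + (D z' z + D z y') := by gcongr; exact innerDist_triangle _ _ _ _
    _ ≤ D x' z' + (D z' z + (D z z'' + D z'' y')) := by gcongr; exact innerDist_triangle _ _ _ _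
    _ ≤ (rho Y x z + ε / 2 / 2) + (ε / 2 / 2 + (ε / 2 / 2 + (rho Y z y + ε / 2 / 2))) := by
        gcongr
        · exact (innerDist_comm _ _ _).trans_le hz'.1.le
        · exact hz''.1.le
    _ = rho Y x z + rho Y z y + ((ε / 2 / 2 + ε / 2 / 2) + (ε / 2 / 2 + ε / 2 / 2)) := by ring
    _ = rho Y x z + rho Y z y + ε := by rw [ENNReal.add_halves, ENNReal.add_halves]

variable [T2Space X]

/-- At a boundary point `z` the two almost shortest paths need not end at points that are close in
`Int Y`, but they are joined by a short arc of a circle around `z`. -/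
lemma rho_triangle_of_mem_boundaryPts (hz : z ∈ boundaryPts Y) (hxz : x ≠ z) (hyz : y ≠ z) :
    rho Y x y ≤ rho Y x z + rho Y z y := by
  obtain ⟨E, hE⟩ := exists_isBoundaryChart hz
  obtain ⟨r₀, hr₀, hr₀t, H⟩ := hE.exists_innerDist_lt
  obtain ⟨r₁, hr₁, -, hr₁N⟩ := hE.exists_radius
    (inter_mem (isOpen_ne.mem_nhds hxz.symm) (isOpen_ne.mem_nhds hyz.symm))
  set r := min r₀ r₁
  have hr : 0 < r := lt_min hr₀ hr₁
  have hrt : Metric.closedBall 0 r ⊆ E.target :=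
    (Metric.closedBall_subset_closedBall (min_le_left _ _)).trans hr₀t
  have hK : IsClosed (E.symm '' Metric.closedBall 0 r) :=
    ((isCompact_closedBall (0 : ℂ) r).image_of_continuousOn
      (E.continuousOn_symm.mono hrt)).isClosed
  have hK' : ∀ p ∈ E.symm '' Metric.closedBall 0 r, p ≠ x ∧ p ≠ y := by
    rintro _ ⟨p, hp, rfl⟩
    exact hr₁N p (Metric.closedBall_subset_closedBall (min_le_right _ _) hp)
  have hxK : (E.symm '' Metric.closedBall 0 r)ᶜ ∈ 𝓝 x :=
    hK.isOpen_compl.mem_nhds fun h ↦ (hK' _ h).1 rfl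
  have hyK : (E.symm '' Metric.closedBall 0 r)ᶜ ∈ 𝓝 y :=
    hK.isOpen_compl.mem_nhds fun h ↦ (hK' _ h).2 rfl
  have hout : ∀ p ∈ (E.symm '' Metric.closedBall 0 r)ᶜ, ¬ (p ∈ E.source ∧ ‖E p‖ < r) :=
    fun p hp ⟨h1, h2⟩ ↦ hp ⟨E p, by simpa using h2.le, E.left_inv h1⟩
  refine ENNReal.le_of_forall_pos_le_add (fun ε hε hfin ↦ rho_le_of_forall_nhds fun S hS T hT ↦ ?_)
  have hε3 : (0 : ℝ≥0∞) < ε / 3 := ENNReal.div_pos (by simpa using hε.ne') (by simp)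
  obtain ⟨δ, hδ, Hδ⟩ := H r hr (min_le_left _ _) (ε / 3) hε3
  have hN := hE.halfDisc_mem_nhds (lt_min hδ hr)
  obtain ⟨x', hx', z', hz', h1⟩ := exists_innerDist_lt_of_rho_lt
    (ENNReal.lt_add_right (ENNReal.add_lt_top.1 hfin).1.ne hε3.ne') (inter_mem hS hxK) hN
  obtain ⟨z'', hz'', y', hy', h2⟩ := exists_innerDist_lt_of_rho_lt
    (ENNReal.lt_add_right (ENNReal.add_lt_top.1 hfin).2.ne hε3.ne') hN (inter_mem hT hyK)
  rw [innerDist_comm] at h2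
  refine ⟨x', ⟨hx'.1.1, hx'.2⟩, y', ⟨hy'.1.1, hy'.2⟩, ?_⟩
  set D := innerDist (interiorPts Y) with hD
  -- an almost shortest path, its part inside the half-disc, and the distance to its start
  have arm : ∀ x' ∈ (E.symm '' Metric.closedBall 0 r)ᶜ, ∀ z' ∈ {p | p ∈ E.source ∧ ‖E p‖ < min δ r},
      ∀ c, D x' z' < c → ∃ A : ℝ → ℂ, ContinuousOn A (Icc 0 1) ∧
        (∀ t ∈ Icc (0 : ℝ) 1, 0 < (A t).re) ∧ (∀ t ∈ Icc (0 : ℝ) 1, ‖A t‖ ≤ r) ∧ ‖A 0‖ = r ∧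
        ‖A 1‖ < δ ∧ ∀ t ∈ Icc (0 : ℝ) 1, D x' (E.symm (A t)) ≤ c := by
    intro x' hx' z' hz' c hc
    obtain ⟨γ, ℓ, hγ, hγU, hγ0, hγ1, -, hℓ0, hℓ1, hℓc, hℓ⟩ := exists_path_length_of_innerDist_lt hc
    obtain ⟨τ, hτ, -, hτ1, hτs, hτc, hτr⟩ := exists_terminal_path (E := E) hγ hrt
      (by rw [hγ0]; exact hout _ hx') (by rw [hγ1]; exact hz'.1)
      (by rw [hγ1]; exact hz'.2.trans_le (min_le_right _ _))
    refine ⟨fun t ↦ E (γ (τ t)), hτc, fun t ht ↦ hE.re_pos (hτs t ht).1 (hγU (hτ ht)),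
      fun t ht ↦ (hτs t ht).2, hτr, ?_, fun t ht ↦ ?_⟩
    · simp only [hτ1, hγ1]; exact hz'.2.trans_le (min_le_left _ _)
    · simp only
      rw [E.left_inv (hτs t ht).1]
      have m0 : (0 : ℝ) ∈ Icc (0 : ℝ) 1 := by simp
      have m1 : (1 : ℝ) ∈ Icc (0 : ℝ) 1 := by simp
      have h3 := hℓ 0 m0 (τ t) (hτ ht) (hτ ht).1
      have h4 := hℓ (τ t) (hτ ht) 1 m1 (hτ ht).2
      rcases le_or_gt (ℓ (τ t)) (ℓ 1) with h5 | h5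
      · rw [hγ0, hℓ0, sub_zero] at h3
        exact h3.trans ((ENNReal.ofReal_le_ofReal h5).trans hℓc.le)
      · -- the remaining part has length zero
        rw [ENNReal.ofReal_of_nonpos (by linarith), nonpos_iff_eq_zero, hγ1, innerDist_comm] at h4
        calc D x' (γ (τ t)) ≤ D x' z' + D z' (γ (τ t)) := innerDist_triangle _ _ _ _
          _ ≤ c := by rw [hD, h4, add_zero]; exact hc.le
  obtain ⟨A, hA, hAre, hAr, hA0, hA1, hAd⟩ := arm x' hx'.1.2 z' hz'.1 _ h1
  obtain ⟨B, hB, hBre, hBr, hB0, hB1, hBd⟩ := arm y' hy'.1.2 z'' hz''.1 _ h2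
  obtain ⟨v, hv, w, hw, hvw⟩ := Hδ A B hA hB hAre hBre hAr hBr hA0 hB0 hA1 hB1
  calc D x' y' ≤ D x' (E.symm (A v)) + D (E.symm (A v)) y' := innerDist_triangle _ _ _ _
    _ ≤ D x' (E.symm (A v)) + (D (E.symm (A v)) (E.symm (B w)) + D (E.symm (B w)) y') := by
        gcongr; exact innerDist_triangle _ _ _ _
    _ ≤ (rho Y x z + ε / 3) + (ε / 3 + (rho Y z y + ε / 3)) := by
        gcongr
        · exact hAd v hv
        · exact (innerDist_comm _ _ _).trans_le (hBd w hw)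
    _ = rho Y x z + rho Y z y + (ε / 3 + ε / 3 + ε / 3) := by ring
    _ = rho Y x z + rho Y z y + ε := by rw [ENNReal.add_thirds]

theorem rho_triangle (hY : IsC0Submanifold Y) (hz : z ∈ Y) (x y : X) :
    rho Y x y ≤ rho Y x z + rho Y z y := by
  rcases mem_interiorPts_or_mem_boundaryPts hY hz with h | h
  · exact rho_triangle_of_mem_interiorPts h
  rcases eq_or_ne x z with rfl | hx
  · exact le_add_self
  rcases eq_or_ne y z with rfl | hy
  · exact le_self_add
  exact rho_triangle_of_mem_boundaryPts h hx hy

/-- Points close to `z` for `rho Y` are close to `z` in `X`. -/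
lemma exists_rho_lt_subset_nhds (Y : Set X) {N : Set X} (hN : N ∈ 𝓝 z) :
    ∃ c : ℝ≥0, 0 < c ∧ ∀ y, rho Y z y < c → y ∈ N := by
  have := isContinuousRiemannianBundle_tangent X
  have : IsManifold (𝓡 2) 1 X := IsManifold.of_le (n := ∞) (by simp)
  have := regularSpace_of_surface X
  obtain ⟨c, hc, h⟩ := setOfPred_riemannianEDist_lt_subset_nhds (𝓡 2) hN
  exact ⟨c, hc, fun y hy ↦ h (riemannianEDist_le_rho.trans_lt hy)⟩

lemma eq_of_rho_eq_zero (h : rho Y x y = 0) : x = y := by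
  by_contra hne
  obtain ⟨c, hc, H⟩ := exists_rho_lt_subset_nhds Y (isOpen_ne.mem_nhds hne)
  exact H y (by rw [h]; exact_mod_cast hc) rfl

theorem isMetricOn_rho (hY : IsC0Submanifold Y) (hfin : RhoFinite Y) : IsMetricOn (rho Y) Y where
  lt_top := hfin
  eq_zero_iff x hx y _ := ⟨eq_of_rho_eq_zero, by
    rintro rfl; exact rho_self (hY.subset_closure_interiorPts hx)⟩
  symm x _ y _ := rho_comm Y x y
  triangle x _ y hy z _ := rho_triangle hY hy x z

/-- A path of the right `rho`-Lipschitz constant is a shortest path. -/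
lemma isShortestPath_of_le (hY : IsC0Submanifold Y) {σ : ℝ → X} (hfin : rho Y x y < ⊤)
    (hσY : MapsTo σ (Icc 0 1) Y) (h0 : σ 0 = x) (h1 : σ 1 = y)
    (hle : ∀ s ∈ Icc (0 : ℝ) 1, ∀ t ∈ Icc (0 : ℝ) 1, s ≤ t →
      rho Y (σ s) (σ t) ≤ ENNReal.ofReal (t - s) * rho Y x y) :
    IsShortestPath (rho Y) Y x y σ where
  continuousOn t ht N hN := by
    obtain ⟨c, hc, H⟩ := exists_rho_lt_subset_nhds Y hN
    have htend : Tendsto (fun s ↦ ENNReal.ofReal |s - t| * rho Y x y) (𝓝 t) (𝓝 0) := by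
      have h2 : Tendsto (fun s ↦ ENNReal.ofReal |s - t|) (𝓝 t) (𝓝 (ENNReal.ofReal |t - t|)) :=
        (ENNReal.continuous_ofReal.comp (by fun_prop)).tendsto t
      simpa using ENNReal.Tendsto.mul_const h2 (Or.inr hfin.ne)
    have hcc : (0 : ℝ≥0∞) < c := by exact_mod_cast hc
    rw [mem_map]
    filter_upwards [nhdsWithin_le_nhds (htend.eventually_lt_const hcc), self_mem_nhdsWithin]
      with s hs hsI
    refine H _ (lt_of_le_of_lt ?_ hs)
    rcases le_total s t with h | h
    · rw [rho_comm, abs_sub_comm, abs_of_nonneg (by linarith)]; exact hle s hsI t ht h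
    · rw [abs_of_nonneg (by linarith)]; exact hle t ht s hsI h
  mapsTo := hσY
  source := h0
  target := h1
  dist_eq s hs t ht hst := by
    refine le_antisymm (hle s hs t ht hst) ?_
    have m0 : (0 : ℝ) ∈ Icc (0 : ℝ) 1 := by simp
    have m1 : (1 : ℝ) ∈ Icc (0 : ℝ) 1 := by simp
    have a1 := hle 0 m0 s hs hs.1
    have a2 := hle t ht 1 m1 ht.2
    have a3 := hle s hs t ht hst
    have htri : rho Y x y ≤ rho Y (σ 0) (σ s) + (rho Y (σ s) (σ t) + rho Y (σ t) (σ 1)) := by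
      conv_lhs => rw [← h0, ← h1]
      refine (rho_triangle hY (hσY hs) _ _).trans ?_
      gcongr
      exact rho_triangle hY (hσY ht) _ _
    obtain ⟨L, hL, hLe⟩ : ∃ L : ℝ, 0 ≤ L ∧ rho Y x y = ENNReal.ofReal L :=
      ⟨_, ENNReal.toReal_nonneg, (ENNReal.ofReal_toReal hfin.ne).symm⟩
    rw [hLe] at a1 a2 a3 htri ⊢
    obtain ⟨D, hD, hDe⟩ : ∃ D : ℝ, 0 ≤ D ∧ rho Y (σ s) (σ t) = ENNReal.ofReal D :=
      ⟨_, ENNReal.toReal_nonneg, (ENNReal.ofReal_toReal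
        (a3.trans_lt (ENNReal.mul_lt_top ENNReal.ofReal_lt_top ENNReal.ofReal_lt_top)).ne).symm⟩
    have b1 : 0 ≤ (s - 0) * L := mul_nonneg (by linarith [hs.1]) hL
    have b2 : 0 ≤ (1 - t) * L := mul_nonneg (by linarith [ht.2]) hL
    have h5 : ENNReal.ofReal L ≤ ENNReal.ofReal ((s - 0) * L + (D + (1 - t) * L)) := by
      rw [ENNReal.ofReal_add b1 (by positivity), ENNReal.ofReal_add hD b2,
        ENNReal.ofReal_mul (by linarith [hs.1]), ENNReal.ofReal_mul (by linarith [ht.2]), ← hDe]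
      exact htri.trans (by gcongr)
    rw [ENNReal.ofReal_le_ofReal_iff (by positivity)] at h5
    rw [hDe, ← ENNReal.ofReal_mul (by linarith)]
    exact ENNReal.ofReal_le_ofReal (by linarith)

/-- Existence of shortest paths in a compact `Y`: almost shortest smooth paths are parametrized
proportionally to their length, and the limit is taken pointwise along an ultrafilter. -/
theorem exists_isShortestPath [FirstCountableTopology X] (hY : IsC0Submanifold Y)
    (hc : IsCompact Y) (hfin : rho Y x y < ⊤) : ∃ σ, IsShortestPath (rho Y) Y x y σ := by
  obtain ⟨S, hS⟩ := (𝓝 x).exists_antitone_basis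
  obtain ⟨T, hT⟩ := (𝓝 y).exists_antitone_basis
  set c : ℕ → ℝ≥0∞ := fun n ↦ rho Y x y + (n : ℝ≥0∞)⁻¹ with hcdef
  have hclim : Tendsto c atTop (𝓝 (rho Y x y)) := by
    simpa using ENNReal.tendsto_inv_nat_nhds_zero.const_add (rho Y x y)
  have hseq : ∀ n, ∃ σ : ℝ → X, σ 0 ∈ S n ∧ σ 1 ∈ T n ∧
      (∀ t ∈ Icc (0 : ℝ) 1, σ t ∈ interiorPts Y) ∧ ∀ s ∈ Icc (0 : ℝ) 1, ∀ t ∈ Icc (0 : ℝ) 1, s ≤ t →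
        innerDist (interiorPts Y) (σ s) (σ t) ≤ ENNReal.ofReal (t - s) * c n := fun n ↦ by
    obtain ⟨x', hx', y', hy', hlt⟩ := exists_innerDist_lt_of_rho_lt
      (ENNReal.lt_add_right (b := (n : ℝ≥0∞)⁻¹) hfin.ne (by simp)) (hS.mem n) (hT.mem n)
    obtain ⟨γ, ℓ, hγ, hγU, hγ0, hγ1, hℓc, hℓ0, hℓ1, hℓlt, hℓ⟩ :=
      exists_path_length_of_innerDist_lt hlt
    have hτ : ∀ t : ℝ, ∃ u ∈ Icc (0 : ℝ) 1, (t ∈ Icc (0 : ℝ) 1 → ℓ u = t * ℓ 1) ∧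
        (t = 0 → u = 0) ∧ (t = 1 → u = 1) := fun t ↦ by
      rcases eq_or_ne t 0 with rfl | ht0
      · exact ⟨0, by simp, by simp [hℓ0], by simp, by simp⟩
      rcases eq_or_ne t 1 with rfl | ht1
      · exact ⟨1, by simp, by simp, by simp, by simp⟩
      by_cases ht : t ∈ Icc (0 : ℝ) 1
      · obtain ⟨u, hu, huℓ⟩ := intermediate_value_Icc zero_le_one hℓc
          (show t * ℓ 1 ∈ Icc (ℓ 0) (ℓ 1) by
            rw [hℓ0]
            exact ⟨mul_nonneg ht.1 hℓ1, mul_le_of_le_one_left hℓ1 ht.2⟩)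
        exact ⟨u, hu, fun _ ↦ huℓ, fun h ↦ absurd h ht0, fun h ↦ absurd h ht1⟩
      · exact ⟨0, by simp, fun h ↦ absurd h ht, fun h ↦ absurd h ht0, fun h ↦ absurd h ht1⟩
    choose τ hτI hτℓ hτ0 hτ1 using hτ
    refine ⟨γ ∘ τ, ?_, ?_, fun t _ ↦ hγU (hτI t), fun s hs t ht hst ↦ ?_⟩
    · simp only [Function.comp_apply, hτ0 0 rfl, hγ0]; exact hx'.1
    · simp only [Function.comp_apply, hτ1 1 rfl, hγ1]; exact hy'.1
    · have hgoal : ENNReal.ofReal (ℓ (τ t) - ℓ (τ s)) ≤ ENNReal.ofReal (t - s) * c n := by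
        rw [hτℓ t ht, hτℓ s hs, ← sub_mul, ENNReal.ofReal_mul (by linarith)]
        gcongr
      rcases le_total (τ s) (τ t) with h | h
      · exact (hℓ _ (hτI s) _ (hτI t) h).trans hgoal
      · -- in this case the portion of the path between the two points has length zero
        have h2 := hℓ _ (hτI t) _ (hτI s) h
        have h3 : s * ℓ 1 ≤ t * ℓ 1 := mul_le_mul_of_nonneg_right hst hℓ1
        rw [hτℓ t ht, hτℓ s hs, ENNReal.ofReal_of_nonpos (by linarith), nonpos_iff_eq_zero,
          innerDist_comm] at h2
        simp only [Function.comp_apply, h2, zero_le]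
  choose σ hσ0 hσ1 hσU hσ using hseq
  let 𝒰 : Ultrafilter ℕ := hyperfilter ℕ
  have h𝒰 : (𝒰 : Filter ℕ) ≤ atTop := Nat.hyperfilter_le_atTop
  have hlim : ∀ t : ℝ, ∃ p, t ∈ Icc (0 : ℝ) 1 → p ∈ Y ∧ Tendsto (fun n ↦ σ n t) 𝒰 (𝓝 p) :=
    fun t ↦ by
      by_cases ht : t ∈ Icc (0 : ℝ) 1
      · obtain ⟨p, hp, hle⟩ := hc.ultrafilter_le_nhds (𝒰.map fun n ↦ σ n t) (by
          rw [le_principal_iff]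
          change ∀ᶠ n in (𝒰 : Filter ℕ), σ n t ∈ Y
          exact Eventually.of_forall fun n ↦ interiorPts_subset (hσU n t ht))
        exact ⟨p, fun _ ↦ ⟨hp, hle⟩⟩
      · exact ⟨x, fun h ↦ absurd h ht⟩
  choose p hp using hlim
  have m0 : (0 : ℝ) ∈ Icc (0 : ℝ) 1 := by simp
  have m1 : (1 : ℝ) ∈ Icc (0 : ℝ) 1 := by simp
  refine ⟨p, isShortestPath_of_le hY hfin (fun t ht ↦ (hp t ht).1)
    (tendsto_nhds_unique (hp 0 m0).2 ((hS.tendsto hσ0).mono_left h𝒰))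
    (tendsto_nhds_unique (hp 1 m1).2 ((hT.tendsto hσ1).mono_left h𝒰)) fun s hs t ht hst ↦ ?_⟩
  exact rho_le_of_tendsto (u := fun n ↦ σ n s) (v := fun n ↦ σ n t)
    (hp s hs).2 (hp t ht).2 (fun n ↦ hσU n s hs) (fun n ↦ hσU n t ht)
    ((ENNReal.Tendsto.const_mul hclim (Or.inr ENNReal.ofReal_ne_top)).mono_left h𝒰)
    (fun n ↦ hσ n s hs t ht hst)

/-- If `Y` is strictly convex, then the triangle inequality is strict for boundary points: a
concatenation of two shortest paths at a boundary point is never a shortest path. -/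
theorem rho_ne_add_of_isStrictlyConvex [FirstCountableTopology X] (hY : IsC0Submanifold Y)
    (hc : IsCompact Y) (hfin : RhoFinite Y) (hconv : IsStrictlyConvex (rho Y) Y) {a b m : X}
    (ha : a ∈ boundaryPts Y) (hm : m ∈ boundaryPts Y) (hb : b ∈ boundaryPts Y) (ham : a ≠ m)
    (hmb : m ≠ b) : rho Y a b ≠ rho Y a m + rho Y m b := by
  intro heq
  have haY := boundaryPts_subset ha
  have hbY := boundaryPts_subset hb
  have hmY := boundaryPts_subset hm
  obtain ⟨σ₁, h₁⟩ := exists_isShortestPath hY hc (hfin a haY m hmY)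
  obtain ⟨σ₂, h₂⟩ := exists_isShortestPath hY hc (hfin m hmY b hbY)
  obtain ⟨L₁, hL₁, hL₁e⟩ : ∃ L : ℝ, 0 < L ∧ rho Y a m = ENNReal.ofReal L :=
    ⟨_, ENNReal.toReal_pos (fun h ↦ ham (eq_of_rho_eq_zero h)) (hfin a haY m hmY).ne,
      (ENNReal.ofReal_toReal (hfin a haY m hmY).ne).symm⟩
  obtain ⟨L₂, hL₂, hL₂e⟩ : ∃ L : ℝ, 0 < L ∧ rho Y m b = ENNReal.ofReal L :=
    ⟨_, ENNReal.toReal_pos (fun h ↦ hmb (eq_of_rho_eq_zero h)) (hfin m hmY b hbY).ne,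
      (ENNReal.ofReal_toReal (hfin m hmY b hbY).ne).symm⟩
  rw [hL₁e, hL₂e, ← ENNReal.ofReal_add hL₁.le hL₂.le] at heq
  set L := L₁ + L₂ with hLdef
  have hL : 0 < L := by positivity
  have hab : a ≠ b := by
    rintro rfl
    rw [rho_self (hY.subset_closure_interiorPts haY)] at heq
    exact absurd heq.symm (by simpa using hL)
  -- the concatenation, parametrized by the fraction of the total length
  set q := L₁ / L with hqdef
  have hq0 : 0 < q := by positivity
  have hq1 : q < 1 := by rw [hqdef, div_lt_one hL]; linarith
  have hqL : q * L = L₁ := by rw [hqdef]; field_simp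
  have hqL' : (1 - q) * L = L₂ := by rw [sub_mul, hqL]; linarith
  let γ : ℝ → X := fun t ↦ if t ≤ q then σ₁ (t / q) else σ₂ ((t - q) / (1 - q))
  have hγ1 : ∀ t ≤ q, γ t = σ₁ (t / q) := fun t ht ↦ if_pos ht
  have hγ2 : ∀ t, q ≤ t → γ t = σ₂ ((t - q) / (1 - q)) := fun t ht ↦ by
    rcases ht.eq_or_lt with h | h
    · rw [← h, hγ1 q le_rfl, div_self hq0.ne', sub_self, zero_div, h₁.target, h₂.source]
    · exact if_neg (not_le.2 h)
  have hI1 : ∀ t, 0 ≤ t → t ≤ q → t / q ∈ Icc (0 : ℝ) 1 := fun t h0 h1 ↦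
    ⟨by positivity, by rw [div_le_one hq0]; exact h1⟩
  have hI2 : ∀ t, q ≤ t → t ≤ 1 → (t - q) / (1 - q) ∈ Icc (0 : ℝ) 1 := fun t h0 h1 ↦
    ⟨div_nonneg (by linarith) (by linarith), by rw [div_le_one (by linarith)]; linarith⟩
  have hd1 : ∀ s t, 0 ≤ s → s ≤ t → t ≤ q → rho Y (γ s) (γ t) = ENNReal.ofReal ((t - s) * L) :=
    fun s t hs hst ht ↦ by
      have h3 : s / q ≤ t / q := div_le_div_of_nonneg_right hst hq0.le
      rw [hγ1 s (hst.trans ht), hγ1 t ht, h₁.dist_eq _ (hI1 s hs (hst.trans ht)) _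
        (hI1 t (hs.trans hst) ht) h3, hL₁e, ← ENNReal.ofReal_mul (by linarith), ← hqL]
      congr 1; field_simp
  have hd2 : ∀ s t, q ≤ s → s ≤ t → t ≤ 1 → rho Y (γ s) (γ t) = ENNReal.ofReal ((t - s) * L) :=
    fun s t hs hst ht ↦ by
      have hq2 : 0 < 1 - q := by linarith
      have h3 : (s - q) / (1 - q) ≤ (t - q) / (1 - q) :=
        div_le_div_of_nonneg_right (by linarith) hq2.le
      rw [hγ2 s hs, hγ2 t (hs.trans hst), h₂.dist_eq _ (hI2 s hs (hst.trans ht)) _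
        (hI2 t (hs.trans hst) ht) h3, hL₂e, ← ENNReal.ofReal_mul (by linarith), ← hqL']
      congr 1; field_simp; ring
  have hγY : MapsTo γ (Icc 0 1) Y := fun t ht ↦ by
    rcases le_total t q with h | h
    · rw [hγ1 t h]; exact h₁.mapsTo (hI1 t ht.1 h)
    · rw [hγ2 t h]; exact h₂.mapsTo (hI2 t h ht.2)
  have hγq : γ q = m := by rw [hγ1 q le_rfl, div_self hq0.ne', h₁.target]
  have hγ : IsShortestPath (rho Y) Y a b γ := by
    refine isShortestPath_of_le hY (hfin a haY b hbY) hγY ?_ ?_ fun s hs t ht hst ↦ ?_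
    · rw [hγ1 0 hq0.le, zero_div, h₁.source]
    · rw [hγ2 1 hq1.le, div_self (by linarith), h₂.target]
    · rw [heq, ← ENNReal.ofReal_mul (by linarith)]
      rcases le_total t q with h | h
      · exact (hd1 s t hs.1 hst h).le
      rcases le_total q s with h' | h'
      · exact (hd2 s t h' hst ht.2).le
      · refine (rho_triangle hY (hγq ▸ hmY : γ q ∈ Y) _ _).trans (le_of_eq ?_)
        rw [hd1 s q hs.1 h' le_rfl, hd2 q t le_rfl h ht.2, ← ENNReal.ofReal_add
          (mul_nonneg (by linarith) hL.le) (mul_nonneg (by linarith) hL.le)]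
        congr 1; ring
  have hint := hconv a haY b hbY hab γ hγ q ⟨hq0, hq1⟩
  rw [hγq] at hint
  exact Set.disjoint_left.1 interiorPts_disjoint_boundaryPts hint hm

end Rho

/-! ### Crossing paths near a boundary point -/

section Arms

variable {X : Type*} [TopologicalSpace X] [T2Space X] {Y : Set X} {z : X}
  {E : OpenPartialHomeomorph X ℂ}

/-- A path that ends at `z` and starts outside the chart disc of radius `r` contains a part that
runs in this disc from its boundary circle to a point at distance less than `δ` from `z`, but does
not reach the end of the path. -/
lemma IsBoundaryChart.exists_arm (hE : IsBoundaryChart Y z E) {ζ : ℝ → X}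
    (hζ : ContinuousOn ζ (Icc 0 1)) (hζ1 : ζ 1 = z) {r δ : ℝ} (hr : 0 < r) (hδ : 0 < δ)
    (hrt : Metric.closedBall 0 r ⊆ E.target) (h0 : ¬ (ζ 0 ∈ E.source ∧ ‖E (ζ 0)‖ < r)) :
    ∃ τ : ℝ → ℝ, MapsTo τ (Icc 0 1) (Ico 0 1) ∧
      (∀ t ∈ Icc (0 : ℝ) 1, ζ (τ t) ∈ E.source ∧ ‖E (ζ (τ t))‖ ≤ r) ∧
      ContinuousOn (fun t ↦ E (ζ (τ t))) (Icc 0 1) ∧ ‖E (ζ (τ 0))‖ = r ∧ ‖E (ζ (τ 1))‖ < δ := by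
  obtain ⟨τ, hτ, hmono, hτ1, hτs, hτc, hτr⟩ := exists_terminal_path hζ hrt h0
    (by rw [hζ1]; exact hE.mem_source) (by rw [hζ1, hE.map_eq_zero]; simpa using hr)
  have hend : Tendsto (fun t ↦ ‖E (ζ (τ t))‖) (𝓝[<] 1) (𝓝 0) := by
    have h1 : Tendsto (fun t ↦ ‖E (ζ (τ t))‖) (𝓝[Icc 0 1] 1) (𝓝 ‖E (ζ (τ 1))‖) :=
      (hτc 1 (by simp)).norm
    rw [hτ1, hζ1, hE.map_eq_zero, norm_zero] at h1
    refine h1.mono_left ?_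
    rw [← nhdsWithin_Ico_eq_nhdsLT (zero_lt_one' ℝ)]
    exact nhdsWithin_mono _ Ico_subset_Icc_self
  obtain ⟨w, hw1, hw2⟩ := ((hend.eventually_lt_const hδ).and
    (Ico_mem_nhdsLT (zero_lt_one' ℝ))).exists
  have hmaps : MapsTo (fun t ↦ t * w) (Icc 0 1) (Ico 0 1) := fun t ht ↦
    ⟨mul_nonneg ht.1 hw2.1, (mul_le_of_le_one_left hw2.1 ht.2).trans_lt hw2.2⟩
  refine ⟨fun t ↦ τ (t * w), fun t ht ↦ ⟨(hτ (Ico_subset_Icc_self (hmaps ht))).1, ?_⟩,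
    fun t ht ↦ hτs _ (Ico_subset_Icc_self (hmaps ht)), ?_, by simpa using hτr, by simpa using hw1⟩
  · rw [← hτ1]; exact hmono (hmaps ht).2
  · exact hτc.comp (by fun_prop) (fun t ht ↦ Ico_subset_Icc_self (hmaps ht))

/-- A path `σ` in `Y` that runs inside a half-disc around the boundary point `z`, avoids `z`, and
joins the two parts of the diameter, meets every path in `Y` from outside the disc to `z`. -/
lemma IsBoundaryChart.exists_eq_of_crossing (hE : IsBoundaryChart Y z E) {ζ σ : ℝ → X}
    (hζ : ContinuousOn ζ (Icc 0 1)) (hζ1 : ζ 1 = z) (hζY : MapsTo ζ (Icc 0 1) Y)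
    (hζz : ∀ t ∈ Ico (0 : ℝ) 1, ζ t ≠ z) {r : ℝ} (hr : 0 < r)
    (hrt : Metric.closedBall 0 r ⊆ E.target) (h0 : ¬ (ζ 0 ∈ E.source ∧ ‖E (ζ 0)‖ < r))
    (hσ : ContinuousOn σ (Icc 0 1)) (hσY : MapsTo σ (Icc 0 1) Y)
    (hσE : ∀ t ∈ Icc (0 : ℝ) 1, σ t ∈ E.source ∧ ‖E (σ t)‖ < r)
    (hσz : ∀ t ∈ Icc (0 : ℝ) 1, σ t ≠ z) (hleft : (E (σ 0)).arg = Real.pi / 2)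
    (hright : (E (σ 1)).arg = -(Real.pi / 2)) :
    ∃ u ∈ Icc (0 : ℝ) 1, ∃ t ∈ Ico (0 : ℝ) 1, σ u = ζ t := by
  have hne : ∀ x ∈ E.source, x ≠ z → E x ≠ 0 := fun x hx hxz h ↦
    hxz (E.injOn hx hE.mem_source (by rw [h, hE.map_eq_zero]))
  have hσc : ContinuousOn (fun t ↦ E (σ t)) (Icc 0 1) :=
    E.continuousOn.comp hσ (fun t ht ↦ (hσE t ht).1)
  obtain ⟨m, hm, hmin⟩ := isCompact_Icc.exists_isMinOn (nonempty_Icc.2 (zero_le_one' ℝ)) hσc.norm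
  obtain ⟨τ, hτ, hτs, hτc, hτ0, hτ1⟩ := hE.exists_arm hζ hζ1 hr
    (norm_pos_iff.2 (hne _ (hσE m hm).1 (hσz m hm))) hrt h0
  obtain ⟨u, hu, v, hv, huv⟩ := BoundaryRigidity.exists_eq_of_crossing hσc hτc
    (fun t ht ↦ (hE.mem_iff _ (hσE t ht).1).1 (hσY ht))
    (fun t ht ↦ (hE.mem_iff _ (hτs t ht).1).1 (hζY (Ico_subset_Icc_self (hτ ht))))
    (fun t ht ↦ hne _ (hσE t ht).1 (hσz t ht))
    (fun t ht ↦ hne _ (hτs t ht).1 (hζz _ (hτ ht)))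
    (fun t ht ↦ by rw [hτ0]; exact (hσE t ht).2.le)
    (fun t ht ↦ hτ1.le.trans (hmin ht)) hleft hright
  exact ⟨u, hu, τ v, hτ hv, E.injOn (hσE u hu).1 (hτs v hv).1 huv⟩

end Arms

section Rho

variable {X : Type*} [TopologicalSpace X] [T2Space X]
  [ChartedSpace (EuclideanSpace ℝ (Fin 2)) X]
  [RiemannianBundle (fun x : X ↦ TangentSpace (𝓡 2) x)]
  [IsManifold (𝓡 2) ∞ X]
  [IsContMDiffRiemannianBundle (𝓡 2) ∞ (EuclideanSpace ℝ (Fin 2))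
      (fun x : X ↦ TangentSpace (𝓡 2) x)] {Y : Set X} {z : X}

/-- Near a boundary point `z`, every path in the interior that ends at `z` passes through points
that are `rho`-close to boundary points on either prescribed side of `z`. The boundary points are
limits of points on radii of the half-disc whose angles tend to `θ = ±π/2`. -/
lemma IsBoundaryChart.exists_rho_le {E : OpenPartialHomeomorph X ℂ} (hE : IsBoundaryChart Y z E) :
    ∃ r₀ > 0, Metric.closedBall 0 r₀ ⊆ E.target ∧ ∀ r, 0 < r → r ≤ r₀ → ∀ ε : ℝ≥0∞, 0 < ε →
      ∀ ζ : ℝ → X, ContinuousOn ζ (Icc 0 1) → ζ 1 = z → (∀ t ∈ Ico (0 : ℝ) 1, ζ t ∈ interiorPts Y) →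
      ¬ (ζ 0 ∈ E.source ∧ ‖E (ζ 0)‖ < r) → ∀ θ : ℝ, |θ| = Real.pi / 2 →
        ∃ t ∈ Ico (0 : ℝ) 1, ∃ s ∈ Ioc 0 r,
          rho Y (ζ t) (E.symm (s * Complex.exp (θ * Complex.I))) ≤ ε := by
  obtain ⟨r₀, hr₀, hr₀t, H⟩ := hE.exists_innerDist_lt
  refine ⟨r₀, hr₀, hr₀t, fun r hr hrr ε hε ζ hζ hζ1 hζU h0 θ hθ ↦ ?_⟩
  have hrt : Metric.closedBall 0 r ⊆ E.target :=
    (Metric.closedBall_subset_closedBall hrr).trans hr₀t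
  obtain ⟨δ, hδ, Hδ⟩ := H r hr hrr ε hε
  obtain ⟨τ, hτ, hτs, hτc, hτ0, hτ1⟩ := hE.exists_arm hζ hζ1 hr hδ hrt h0
  have hpi := Real.pi_pos
  let θn : ℕ → ℝ := fun n ↦ θ * (1 - 1 / ((n : ℝ) + 1 + 1))
  have hθn : ∀ n, |θn n| < Real.pi / 2 := fun n ↦ by
    have h1 : (0 : ℝ) < 1 / ((n : ℝ) + 1 + 1) := by positivity
    have h2 : 1 / ((n : ℝ) + 1 + 1) ≤ 1 := by
      rw [div_le_one (by positivity)]; linarith [Nat.cast_nonneg (α := ℝ) n]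
    rw [abs_mul, hθ, abs_of_nonneg (by linarith)]
    exact mul_lt_of_lt_one_right (by positivity) (by linarith)
  have hθlim : Tendsto θn atTop (𝓝 θ) := by
    have h1 := (tendsto_one_div_add_atTop_nhds_zero_nat (𝕜 := ℝ)).comp (tendsto_add_atTop_nat 1)
    have h2 : Tendsto (fun n : ℕ ↦ θ * (1 - 1 / ((n : ℝ) + 1 + 1))) atTop (𝓝 (θ * (1 - 0))) := by
      refine (tendsto_const_nhds.sub ?_).const_mul θ
      simpa [Function.comp_def] using h1
    rwa [sub_zero, mul_one] at h2
  let m : ℝ := min (δ / 2) r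
  have hm : 0 < m := by positivity
  let ρ : ℝ → ℝ := fun w ↦ r + w * (m - r)
  have hρ : ∀ w ∈ Icc (0 : ℝ) 1, ρ w ∈ Icc m r := fun w hw ↦ by
    have h1 : m ≤ r := min_le_right _ _
    have h2 : w * (r - m) ≤ 1 * (r - m) := mul_le_mul_of_nonneg_right hw.2 (by linarith)
    have h3 : 0 ≤ w * (r - m) := mul_nonneg hw.1 (by linarith)
    simp only [ρ]
    constructor <;> nlinarith
  have hρ0 : ∀ w ∈ Icc (0 : ℝ) 1, 0 < ρ w := fun w hw ↦ hm.trans_le (hρ w hw).1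
  have hBn : ∀ w ∈ Icc (0 : ℝ) 1, ∀ φ : ℝ, ‖(ρ w : ℂ) * Complex.exp (φ * Complex.I)‖ = ρ w :=
    fun w hw φ ↦ by
      rw [norm_mul, Complex.norm_exp_ofReal_mul_I, mul_one, Complex.norm_real,
        Real.norm_of_nonneg (hρ0 w hw).le]
  have hτI : ∀ t ∈ Icc (0 : ℝ) 1, ζ (τ t) ∈ interiorPts Y := fun t ht ↦ hζU _ (hτ ht)
  have hBre : ∀ n, ∀ w ∈ Icc (0 : ℝ) 1, 0 < ((ρ w : ℂ) * Complex.exp (θn n * Complex.I)).re :=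
    fun n w hw ↦ by
      rw [Complex.re_ofReal_mul, Complex.exp_ofReal_mul_I_re]
      exact mul_pos (hρ0 w hw) (Real.cos_pos_of_mem_Ioo (abs_lt.1 (hθn n)))
  have hstep : ∀ n : ℕ, ∃ p ∈ Icc (0 : ℝ) 1 ×ˢ Icc (0 : ℝ) 1, innerDist (interiorPts Y)
      (ζ (τ p.1)) (E.symm ((ρ p.2 : ℂ) * Complex.exp (θn n * Complex.I))) ≤ ε := fun n ↦ by
    obtain ⟨v, hv, w, hw, h⟩ := Hδ (fun t ↦ E (ζ (τ t)))
      (fun w ↦ (ρ w : ℂ) * Complex.exp (θn n * Complex.I)) hτc (by fun_prop)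
      (fun t ht ↦ hE.re_pos (hτs t ht).1 (hτI t ht)) (hBre n) (fun t ht ↦ (hτs t ht).2)
      (fun w hw ↦ (hBn w hw _).trans_le (hρ w hw).2) hτ0
      ((hBn 0 (by simp) _).trans (by simp [ρ])) hτ1
      (by
        rw [hBn 1 (by simp)]
        have : m ≤ δ / 2 := min_le_left _ _
        simp only [ρ]; linarith)
    refine ⟨(v, w), ⟨hv, hw⟩, ?_⟩
    rw [E.left_inv (hτs v hv).1] at h
    exact h.le
  choose p hpI hp using hstep
  obtain ⟨⟨v, w⟩, ⟨hv, hw⟩, φ, hφ, hlim⟩ :=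
    (isCompact_Icc.prod isCompact_Icc).tendsto_subseq hpI
  have hball : ∀ w ∈ Icc (0 : ℝ) 1, ∀ φ : ℝ,
      (ρ w : ℂ) * Complex.exp (φ * Complex.I) ∈ E.target := fun w hw φ ↦
    hrt (by simpa only [mem_closedBall_zero_iff] using (hBn w hw φ).trans_le (hρ w hw).2)
  refine ⟨τ v, hτ hv, ρ w, ⟨hρ0 w hw, (hρ w hw).2⟩, ?_⟩
  refine rho_le_of_tendsto (F := atTop) (u := fun n ↦ ζ (τ (p (φ n)).1))
    (v := fun n ↦ E.symm ((ρ (p (φ n)).2 : ℂ) * Complex.exp (θn (φ n) * Complex.I)))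
    (g := fun _ ↦ ε) ?_ ?_ (fun n ↦ hτI _ (hpI _).1)
    (fun n ↦ hE.mem_interiorPts (E.map_target (hball _ (hpI _).2 _))
      (by rw [E.right_inv (hball _ (hpI _).2 _)]; exact hBre _ _ (hpI _).2))
    tendsto_const_nhds (fun n ↦ hp _)
  · have hc : ContinuousOn (fun t ↦ ζ (τ t)) (Icc 0 1) :=
      (E.continuousOn_symm.comp hτc (fun t ht ↦ E.map_source (hτs t ht).1)).congr
        (fun t ht ↦ (E.left_inv (hτs t ht).1).symm)
    have h1 : Tendsto (fun n ↦ (p (φ n)).1) atTop (𝓝[Icc 0 1] v) :=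
      tendsto_nhdsWithin_iff.2 ⟨(continuous_fst.tendsto _).comp hlim,
        Eventually.of_forall fun n ↦ (hpI _).1⟩
    exact Tendsto.comp (g := fun t ↦ ζ (τ t)) (hc v hv) h1
  · refine (E.continuousAt_symm (hball w hw θ)).tendsto.comp ?_
    have h1 : Tendsto (fun n ↦ (p (φ n)).2) atTop (𝓝 w) := (continuous_snd.tendsto _).comp hlim
    have h2 : Tendsto (fun n ↦ θn (φ n)) atTop (𝓝 θ) := hθlim.comp hφ.tendsto_atTop
    have h3 : Continuous fun q : ℝ × ℝ ↦ (ρ q.1 : ℂ) * Complex.exp (q.2 * Complex.I) := by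
      simp only [ρ]; fun_prop
    exact Tendsto.comp (g := fun q : ℝ × ℝ ↦ (ρ q.1 : ℂ) * Complex.exp (q.2 * Complex.I))
      (f := fun n ↦ ((p (φ n)).2, θn (φ n))) (h3.tendsto (w, θ)) (h1.prodMk_nhds h2)

/-- If the triangle inequality is strict for triples of boundary points, then `Y` is strictly
convex. -/
theorem isStrictlyConvex_of_rho_ne_add [FirstCountableTopology X] (hY : IsC0Submanifold Y)
    (hc : IsCompact Y) (hfin : RhoFinite Y)
    (hstrict : ∀ a ∈ boundaryPts Y, ∀ m ∈ boundaryPts Y, ∀ b ∈ boundaryPts Y, a ≠ m → m ≠ b →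
      rho Y a b ≠ rho Y a m + rho Y m b) : IsStrictlyConvex (rho Y) Y := by
  intro α hα β hβ hαβ γ hγ t₀ ht₀
  by_contra hnot
  have ht₀' : t₀ ∈ Icc (0 : ℝ) 1 := Ioo_subset_Icc_self ht₀
  have m0 : (0 : ℝ) ∈ Icc (0 : ℝ) 1 := by simp
  have m1 : (1 : ℝ) ∈ Icc (0 : ℝ) 1 := by simp
  have hdich : ∀ t ∈ Icc (0 : ℝ) 1, γ t ∈ interiorPts Y ∨ γ t ∈ boundaryPts Y := fun t ht ↦
    mem_interiorPts_or_mem_boundaryPts hY (hγ.mapsTo ht)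
  have hz : γ t₀ ∈ boundaryPts Y := (hdich t₀ ht₀').resolve_left hnot
  set z := γ t₀ with hzdef
  have hLfin : rho Y α β ≠ ⊤ := (hfin α hα β hβ).ne
  have hL0 : rho Y α β ≠ 0 := fun h ↦ hαβ (eq_of_rho_eq_zero h)
  have hself : ∀ x ∈ Y, rho Y x x = 0 := fun x hx ↦ rho_self (hY.subset_closure_interiorPts hx)
  have hinj : ∀ s ∈ Icc (0 : ℝ) 1, ∀ t ∈ Icc (0 : ℝ) 1, s < t → γ s ≠ γ t :=
    fun s hs t ht hst h ↦ by
      have h1 := hγ.dist_eq s hs t ht hst.le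
      rw [h, hself _ (hγ.mapsTo ht)] at h1
      rcases mul_eq_zero.1 h1.symm with h2 | h2
      · rw [ENNReal.ofReal_eq_zero] at h2; linarith
      · exact hL0 h2
  -- a shortest path contains at most two boundary points
  have hthree : ∀ s ∈ Icc (0 : ℝ) 1, ∀ t ∈ Icc (0 : ℝ) 1, ∀ u ∈ Icc (0 : ℝ) 1, s < t → t < u →
      γ s ∈ boundaryPts Y → γ t ∈ boundaryPts Y → γ u ∈ boundaryPts Y → False :=
    fun s hs t ht u hu hst htu h1 h2 h3 ↦ hstrict _ h1 _ h2 _ h3 (hinj s hs t ht hst)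
      (hinj t ht u hu htu) (hγ.add hs ht hu hst.le htu.le)
  obtain ⟨s₁, hs₁, hs₁t, hfree₁⟩ : ∃ s₁ ∈ Icc (0 : ℝ) 1, s₁ < t₀ ∧
      ∀ t ∈ Ico s₁ t₀, γ t ∈ interiorPts Y := by
    by_cases h : ∃ s ∈ Ico (0 : ℝ) t₀, γ s ∈ boundaryPts Y
    · obtain ⟨s, hs, hsb⟩ := h
      have hsI : s ∈ Icc (0 : ℝ) 1 := ⟨hs.1, hs.2.le.trans ht₀'.2⟩
      refine ⟨(s + t₀) / 2, ⟨by linarith [hs.1, ht₀.1], by linarith [hs.2, ht₀.2]⟩,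
        by linarith [hs.2], fun t ht ↦ ?_⟩
      have htI : t ∈ Icc (0 : ℝ) 1 := ⟨by linarith [hs.1, ht.1, hs.2], ht.2.le.trans ht₀'.2⟩
      exact (hdich t htI).resolve_right fun hb ↦
        hthree s hsI t htI t₀ ht₀' (by linarith [ht.1, hs.2]) ht.2 hsb hb hz
    · push Not at h
      exact ⟨0, m0, ht₀.1, fun t ht ↦ (hdich t ⟨ht.1, ht.2.le.trans ht₀'.2⟩).resolve_right (h t ht)⟩
  obtain ⟨s₂, hs₂, hs₂t, hfree₂⟩ : ∃ s₂ ∈ Icc (0 : ℝ) 1, t₀ < s₂ ∧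
      ∀ t ∈ Ioc t₀ s₂, γ t ∈ interiorPts Y := by
    by_cases h : ∃ s ∈ Ioc t₀ 1, γ s ∈ boundaryPts Y
    · obtain ⟨s, hs, hsb⟩ := h
      have hsI : s ∈ Icc (0 : ℝ) 1 := ⟨ht₀'.1.trans hs.1.le, hs.2⟩
      refine ⟨(s + t₀) / 2, ⟨by linarith [hs.1, ht₀.1], by linarith [hs.2, ht₀.2]⟩,
        by linarith [hs.1], fun t ht ↦ ?_⟩
      have htI : t ∈ Icc (0 : ℝ) 1 := ⟨ht₀'.1.trans ht.1.le, by linarith [hs.1, ht.2, hs.2]⟩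
      exact (hdich t htI).resolve_right fun hb ↦
        hthree t₀ ht₀' t htI s hsI ht.1 (by linarith [ht.2, hs.1]) hz hb hsb
    · push Not at h
      exact ⟨1, m1, ht₀.2, fun t ht ↦ (hdich t ⟨ht₀'.1.trans ht.1.le, ht.2⟩).resolve_right (h t ht)⟩
  -- the path `arm s` runs along `γ` from `γ s` to `z`
  let arm : ℝ → ℝ → X := fun s τ ↦ γ (s + τ * (t₀ - s))
  have harmI : ∀ s ∈ Icc (0 : ℝ) 1, MapsTo (fun τ ↦ s + τ * (t₀ - s)) (Icc 0 1) (Icc 0 1) :=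
    fun s hs τ hτ ↦ by
      have := (convex_Icc (0 : ℝ) 1) hs ht₀' (a := 1 - τ) (b := τ) (by linarith [hτ.2]) hτ.1
        (by ring)
      convert this using 1
      simp only [smul_eq_mul]; ring
  have harmc : ∀ s ∈ Icc (0 : ℝ) 1, ContinuousOn (arm s) (Icc 0 1) := fun s hs ↦
    hγ.continuousOn.comp (by fun_prop) (harmI s hs)
  have harm0 : ∀ s, arm s 0 = γ s := fun s ↦ by simp [arm]
  have harm1 : ∀ s, arm s 1 = z := fun s ↦ by simp [arm, hzdef]
  obtain ⟨E, hE⟩ := exists_isBoundaryChart hz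
  obtain ⟨r₀, hr₀, hr₀t, Hside⟩ := hE.exists_rho_le
  have hsz₁ : γ s₁ ≠ z := hinj s₁ hs₁ t₀ ht₀' hs₁t
  have hsz₂ : z ≠ γ s₂ := hinj t₀ ht₀' s₂ hs₂ hs₂t
  obtain ⟨r₁, hr₁, hr₁t, hr₁N⟩ := hE.exists_radius
    (inter_mem (isOpen_ne.mem_nhds hsz₁.symm) (isOpen_ne.mem_nhds hsz₂))
  have hout₁ : ¬ (γ s₁ ∈ E.source ∧ ‖E (γ s₁)‖ < r₁) := fun ⟨h1, h2⟩ ↦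
    (hr₁N (E (γ s₁)) (by simpa using h2.le)).1 (E.left_inv h1)
  have hout₂ : ¬ (γ s₂ ∈ E.source ∧ ‖E (γ s₂)‖ < r₁) := fun ⟨h1, h2⟩ ↦
    (hr₁N (E (γ s₂)) (by simpa using h2.le)).2 (E.left_inv h1)
  obtain ⟨c, hcpos, hcN⟩ := exists_rho_lt_subset_nhds Y (hE.halfDisc_mem_nhds hr₁)
  obtain ⟨ε, hε, hε6⟩ : ∃ ε : ℝ≥0∞, 0 < ε ∧ (ε + ε) + ((ε + ε) + (ε + ε)) < c := by
    refine ⟨((c / 7 : ℝ≥0) : ℝ≥0∞), by exact_mod_cast (by positivity), ?_⟩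
    have : (c / 7 + c / 7) + ((c / 7 + c / 7) + (c / 7 + c / 7)) < c := by
      rw [← NNReal.coe_lt_coe]; push_cast
      have : (0 : ℝ) < c := hcpos
      linarith
    exact_mod_cast this
  -- a short subarc `γ [t₀, s₃]`, in the `rho`-distance
  obtain ⟨s₃, hs₃t, hs₃s, hs₃⟩ : ∃ s₃, t₀ < s₃ ∧ s₃ ≤ s₂ ∧
      ENNReal.ofReal (s₃ - t₀) * rho Y α β ≤ ε := by
    have htend : Tendsto (fun s ↦ ENNReal.ofReal (s - t₀) * rho Y α β) (𝓝[>] t₀) (𝓝 0) := by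
      have h2 : Tendsto (fun s ↦ ENNReal.ofReal (s - t₀)) (𝓝 t₀) (𝓝 (ENNReal.ofReal (t₀ - t₀))) :=
        (ENNReal.continuous_ofReal.comp (by fun_prop)).tendsto t₀
      have h3 := ENNReal.Tendsto.mul_const h2 (Or.inr hLfin)
      rw [sub_self, ENNReal.ofReal_zero, zero_mul] at h3
      exact h3.mono_left nhdsWithin_le_nhds
    obtain ⟨s, h1, h2, h3⟩ := ((htend.eventually_lt_const hε).and (Ioc_mem_nhdsGT hs₂t)).exists
    exact ⟨s, h2, h3, h1.le⟩
  have hs₃I : s₃ ∈ Icc (0 : ℝ) 1 := ⟨ht₀'.1.trans hs₃t.le, hs₃s.trans hs₂.2⟩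
  obtain ⟨r₂, hr₂, -, hr₂N⟩ := hE.exists_radius
    (isOpen_ne.mem_nhds (hinj t₀ ht₀' s₃ hs₃I hs₃t))
  set r := min r₀ r₂
  have hr : 0 < r := lt_min hr₀ hr₂
  have hout₃ : ¬ (γ s₃ ∈ E.source ∧ ‖E (γ s₃)‖ < r) := fun ⟨h1, h2⟩ ↦
    hr₂N (E (γ s₃)) (by simpa using h2.le.trans (min_le_right _ _)) (E.left_inv h1)
  -- boundary points on both sides of `z` that are close to `z` for `rho`
  have hnear : ∀ θ : ℝ, |θ| = Real.pi / 2 → ∃ a ∈ boundaryPts Y, a ∈ E.source ∧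
      (E a).arg = θ ∧ a ≠ z ∧ rho Y z a ≤ ε + ε := by
    intro θ hθ
    have hpi := Real.pi_pos
    obtain ⟨τ, hτ, s, hs, hle⟩ := Hside r hr (min_le_left _ _) ε hε (arm s₃) (harmc s₃ hs₃I)
      (harm1 s₃) (fun τ hτ ↦ hfree₂ _ ⟨by
        nlinarith [mul_pos (sub_pos.2 hτ.2) (sub_pos.2 hs₃t)], by
        nlinarith [mul_nonneg hτ.1 (sub_pos.2 hs₃t).le]⟩)
      (by rw [harm0]; exact hout₃) θ hθ
    set p : ℂ := s * Complex.exp (θ * Complex.I) with hp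
    have hpn : ‖p‖ = s := by
      rw [hp, norm_mul, Complex.norm_exp_ofReal_mul_I, mul_one, Complex.norm_real,
        Real.norm_of_nonneg hs.1.le]
    have hpt : p ∈ E.target := hr₀t (by
      simpa [hpn] using hs.2.trans (min_le_left _ _))
    have hpE : E (E.symm p) = p := E.right_inv hpt
    refine ⟨E.symm p, hE.mem_boundaryPts (E.map_target hpt) ?_, E.map_target hpt, ?_, ?_, ?_⟩
    · rw [hpE, hp, Complex.re_ofReal_mul, Complex.exp_ofReal_mul_I_re, ← Real.cos_abs, hθ,
        Real.cos_pi_div_two, mul_zero]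
    · have := abs_le.1 hθ.le
      rw [hpE, hp, Complex.arg_real_mul _ hs.1, Complex.arg_exp_mul_I]
      exact (toIocMod_eq_self _).2 ⟨by linarith, by linarith⟩
    · intro h
      have : p = 0 := by rw [← hpE, h, hE.map_eq_zero]
      rw [this, norm_zero] at hpn
      exact hs.1.ne hpn
    · have hτI := harmI s₃ hs₃I (Ico_subset_Icc_self hτ)
      refine (rho_triangle hY (hγ.mapsTo hτI) _ _).trans (add_le_add ?_ hle)
      rw [hγ.dist_eq t₀ ht₀' _ hτI (by
        nlinarith [mul_nonneg (sub_nonneg.2 hτ.2.le) (sub_pos.2 hs₃t).le])]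
      refine le_trans ?_ hs₃
      gcongr
      nlinarith [mul_nonneg hτ.1 (sub_pos.2 hs₃t).le]
  have hpi := Real.pi_pos
  obtain ⟨a, ha, haE, haθ, haz, hza⟩ := hnear (Real.pi / 2) (abs_of_pos (by linarith))
  obtain ⟨b, hb, hbE, hbθ, hbz, hzb⟩ := hnear (-(Real.pi / 2))
    (by rw [abs_neg, abs_of_pos (by linarith)])
  have hzY : z ∈ Y := boundaryPts_subset hz
  have haY := boundaryPts_subset ha
  have hbY := boundaryPts_subset hb
  -- a shortest path from `a` to `b` stays close to `z` but avoids `z`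
  obtain ⟨σ, hσ⟩ := exists_isShortestPath hY hc (hfin a haY b hbY)
  have hσ01 : ∀ u ∈ Icc (0 : ℝ) 1, rho Y a b = rho Y a (σ u) + rho Y (σ u) b := fun u hu ↦ by
    have := hσ.add m0 hu m1 hu.1 hu.2
    rwa [hσ.source, hσ.target] at this
  have hσz : ∀ u ∈ Icc (0 : ℝ) 1, σ u ≠ z := fun u hu h ↦
    hstrict a ha z hz b hb haz hbz.symm (h ▸ hσ01 u hu)
  have hσE : ∀ u ∈ Icc (0 : ℝ) 1, σ u ∈ E.source ∧ ‖E (σ u)‖ < r₁ := fun u hu ↦ by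
    refine hcN _ (lt_of_le_of_lt ?_ hε6)
    refine (rho_triangle hY haY _ _).trans (add_le_add hza ?_)
    refine (le_self_add.trans (hσ01 u hu).ge).trans ?_
    refine (rho_triangle hY hzY _ _).trans (add_le_add ?_ hzb)
    rw [rho_comm]; exact hza
  -- it crosses both parts of `γ`
  have hcross : ∀ s ∈ Icc (0 : ℝ) 1, s ≠ t₀ → ¬ (γ s ∈ E.source ∧ ‖E (γ s)‖ < r₁) →
      ∃ u ∈ Icc (0 : ℝ) 1, ∃ τ ∈ Ico (0 : ℝ) 1, σ u = arm s τ := fun s hs hst hout ↦ by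
    refine hE.exists_eq_of_crossing (harmc s hs) (harm1 s) (fun τ hτ ↦ hγ.mapsTo (harmI s hs hτ))
      (fun τ hτ ↦ ?_) hr₁ hr₁t (by rw [harm0]; exact hout) hσ.continuousOn hσ.mapsTo hσE hσz
      (by rw [hσ.source, haθ]) (by rw [hσ.target, hbθ])
    have hτI := harmI s hs (Ico_subset_Icc_self hτ)
    rcases hst.lt_or_gt with h | h
    · refine hinj _ hτI t₀ ht₀' ?_
      nlinarith [mul_pos (sub_pos.2 hτ.2) (sub_pos.2 h)]
    · refine (hinj t₀ ht₀' _ hτI ?_).symm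
      nlinarith [mul_pos (sub_pos.2 hτ.2) (sub_pos.2 h)]
  obtain ⟨u₁, hu₁, τ₁, hτ₁, h₁⟩ := hcross s₁ hs₁ hs₁t.ne hout₁
  obtain ⟨u₂, hu₂, τ₂, hτ₂, h₂⟩ := hcross s₂ hs₂ hs₂t.ne' hout₂
  have hpq : rho Y (σ u₁) (σ u₂) = rho Y (σ u₁) z + rho Y z (σ u₂) := by
    rw [h₁, h₂]
    refine hγ.add (harmI s₁ hs₁ (Ico_subset_Icc_self hτ₁)) ht₀'
      (harmI s₂ hs₂ (Ico_subset_Icc_self hτ₂)) ?_ ?_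
    · nlinarith [mul_nonneg (sub_nonneg.2 hτ₁.2.le) (sub_nonneg.2 hs₁t.le)]
    · nlinarith [mul_nonneg (sub_nonneg.2 hτ₂.2.le) (sub_nonneg.2 hs₂t.le)]
  -- so replacing a part of `σ` by a part of `γ` gives a shortest path through `z`
  have hfinal : ∀ u ∈ Icc (0 : ℝ) 1, ∀ v ∈ Icc (0 : ℝ) 1, u ≤ v →
      rho Y (σ u) (σ v) = rho Y (σ u) z + rho Y z (σ v) → False := fun u hu v hv huv h ↦ by
    refine hstrict a ha z hz b hb haz hbz.symm (le_antisymm (rho_triangle hY hzY _ _) ?_)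
    have e1 : rho Y a b = rho Y a (σ u) + (rho Y (σ u) (σ v) + rho Y (σ v) b) := by
      rw [hσ01 u hu]
      congr 1
      have := hσ.add hu hv m1 huv hv.2
      rwa [hσ.target] at this
    calc rho Y a z + rho Y z b
        ≤ (rho Y a (σ u) + rho Y (σ u) z) + (rho Y z (σ v) + rho Y (σ v) b) :=
          add_le_add (rho_triangle hY (hσ.mapsTo hu) _ _) (rho_triangle hY (hσ.mapsTo hv) _ _)
      _ = rho Y a (σ u) + ((rho Y (σ u) z + rho Y z (σ v)) + rho Y (σ v) b) := by
          simp only [add_assoc]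
      _ = rho Y a b := by rw [← h, ← e1]
  rcases le_total u₁ u₂ with h | h
  · exact hfinal u₁ hu₁ u₂ hu₂ h hpq
  · refine hfinal u₂ hu₂ u₁ hu₁ h ?_
    rw [rho_comm, hpq, add_comm, rho_comm Y z, rho_comm Y (σ u₁)]

end Rho

end BoundaryRigidity

theorem theorem3p4 {X : Type*} [TopologicalSpace X] [T2Space X] [SecondCountableTopology X]
    [ConnectedSpace X] [ChartedSpace (EuclideanSpace ℝ (Fin 2)) X] [IsManifold (𝓡 2) ∞ X]
    [RiemannianBundle (fun x : X ↦ TangentSpace (𝓡 2) x)]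
    [IsContMDiffRiemannianBundle (𝓡 2) ∞ (EuclideanSpace ℝ (Fin 2))
      (fun x : X ↦ TangentSpace (𝓡 2) x)]
    (Y₁ Y₂ : Set X)
    (hcompact₁ : IsCompact Y₁) (hconn₁ : IsConnected Y₁)
    (hsub₁ : BoundaryRigidity.IsC0Submanifold Y₁) (hbdry₁ : (BoundaryRigidity.boundaryPts Y₁).Nonempty)
    (hfin₁ : BoundaryRigidity.RhoFinite Y₁)
    (hconv₁ : BoundaryRigidity.IsStrictlyConvex (BoundaryRigidity.rho Y₁) Y₁)
    (hcompact₂ : IsCompact Y₂) (hconn₂ : IsConnected Y₂)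
    (hsub₂ : BoundaryRigidity.IsC0Submanifold Y₂) (hbdry₂ : (BoundaryRigidity.boundaryPts Y₂).Nonempty)
    (hfin₂ : BoundaryRigidity.RhoFinite Y₂)
    (hiso : ∃ f : BoundaryRigidity.boundaryPts Y₁ ≃ BoundaryRigidity.boundaryPts Y₂,
      ∀ x y : BoundaryRigidity.boundaryPts Y₁,
        BoundaryRigidity.rho Y₂ (f x) (f y) = BoundaryRigidity.rho Y₁ x y) :
    BoundaryRigidity.IsMetricOn (BoundaryRigidity.rho Y₂) Y₂ ∧
      BoundaryRigidity.IsStrictlyConvex (BoundaryRigidity.rho Y₂) Y₂ := by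

  obtain ⟨f, hf⟩ := hiso
  refine ⟨BoundaryRigidity.isMetricOn_rho hsub₂ hfin₂,
    BoundaryRigidity.isStrictlyConvex_of_rho_ne_add hsub₂ hcompact₂ hfin₂
      fun a ha m hm b hb ham hmb heq ↦ ?_⟩
  -- the preimages of the three points violate the strict triangle inequality on `∂Y₁`
  obtain ⟨a', ha'⟩ := f.surjective ⟨a, ha⟩
  obtain ⟨m', hm'⟩ := f.surjective ⟨m, hm⟩
  obtain ⟨b', hb'⟩ := f.surjective ⟨b, hb⟩
  refine BoundaryRigidity.rho_ne_add_of_isStrictlyConvex hsub₁ hcompact₁ hfin₁ hconv₁ a'.2 m'.2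
    b'.2 (fun h ↦ ham ?_) (fun h ↦ hmb ?_) ?_
  · exact congrArg Subtype.val (ha'.symm.trans ((congrArg f (Subtype.ext h)).trans hm'))
  · exact congrArg Subtype.val (hm'.symm.trans ((congrArg f (Subtype.ext h)).trans hb'))
  · rw [← hf a' b', ← hf a' m', ← hf m' b', ha', hm', hb']
    exact heq
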